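/- Fix a non-empty set $\mathcal R$ (the signature) and a countably infinite set of variables. Sp-formulas are built from variables and $\top$ by $\wedge$ and unary diamonds $\Diamond_R$ ($R\in\mathcal R$); an sp-implication is an expression $\sigma\to\tau$ with $\sigma,\tau$ sp-formulas. A (Kripke) frame $F$ is a non-empty set with a binary relation $R^F$ for each $R\in\mathcal R$; truth of sp-formulas in models over $F$ is as in modal logic, and $F\models\sigma\to\tau$ means that, under every valuation, $\tau$ is true wherever $\sigma$ is. An SLO is a meet-semilattice with top $\top$ and monotone unary operators $\Diamond_R$; it validates $\sigma\to\tau$ if $\sigma\le\tau$ under every valuation. For a set $\Sigma$ of sp-implications, $\Sigma\models_{\mathrm{Kr}}\iota$ (resp. $\Sigma\models_{\mathrm{SLO}}\iota$) means that $\iota$ is valid in every frame (resp. SLO) validating $\Sigma$. The logic $\mathsf{SPi}+\Sigma$ is the set of sp-implications derivable from substitution instances of members of $\Sigma$ and of $p\to p$, $p\to\top$, $p\wedge q\to q\wedge p$, $p\wedge q\to p$ by the rules $\frac{\sigma\to\tau\ \ \tau\to\varrho}{\sigma\to\varrho}$, $\frac{\sigma\to\tau\ \ \sigma\to\varrho}{\sigma\to\tau\wedge\varrho}$,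 $\frac{\sigma\to\tau}{\Diamond_R\sigma\to\Diamond_R\tau}$. It is complete if $\Sigma\models_{\mathrm{Kr}}\iota\iff\Sigma\models_{\mathrm{SLO}}\iota$ for all sp-implications $\iota$. A profile is a quadruple $\pi=(G,S,u,v)$ where $G$ is a finite rooted frame (every point is reachable from some fixed point along arrows of any of the relations), $S\in\mathcal R$, $u,v\in G$ and $(u,v)\notin S^G$. It represents the universal Horn sentence $\Phi_\pi$: for every map $h$ from $G$ to the frame $F$, if $h$ maps $R$-arrows of $G$ to $R$-arrows of $F$ for all $R\in\mathcal R$, then $(h(u),h(v))\in S^F$. An sp-implication $\iota$ is a Horn-implication with profile $\pi$ if, for every frame $F$, $F\models\iota$ iff $F\models\Phi_\pi$. For a set $\Pi$ of profiles, the $\Pi$-closure of a frame $F$ is the smallest frame with the same points that contains the arrows of $F$ and satisfies $\Phi_\pi$ for all $\pi\in\Pi$; the $\Pi$-closure of a model has the same valuation. The tree model $M_\sigma$ with root $r_\sigma$ is defined by induction: for $\top$ and for a variable $p$ it is a single point without arrows, at which no variable (resp. only $p$) is true; for $\sigma_1\wedge\sigma_2$ it is the disjoint union of $M_{\sigma_1}$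 and $M_{\sigma_2}$ with the roots identified; for $\Diamond_R\sigma'$ it is $M_{\sigma'}$ with a fresh root and an $R$-arrow from it to $r_{\sigma'}$. **Theorem.** Let $\Sigma$ be a finite set of Horn-implications and $L=\mathsf{SPi}+\Sigma$. (1) $L$ has the polynomial finite frame property: there is a polynomial $P$ such that every sp-implication $\iota$ that fails in some frame validating $L$ fails in a frame validating $L$ whose size (number of points plus number of labelled arrows) is at most $P(|\iota|)$, where $|\iota|$ is the number of symbols of $\iota$. (2) Let $\Pi_\Sigma$ consist of one profile for each $\iota\in\Sigma$. Then, for all sp-formulas $\sigma,\tau$, we have $\Sigma\models_{\mathrm{Kr}}\sigma\to\tau$ if and only if $\tau$ is true at $r_\sigma$ in the $\Pi_\Sigma$-closure of $M_\sigma$. (3) If $L$ is complete, then $L$ is decidable in polynomial time: whenever the symbols of $\mathcal R$ and the variables are given distinct binary names, and sp-implications are written as words over a finite alphabet in prefix notation using these names, there is a Turing machine that, given the word of an sp-implication $\iota$, decides whether $\iota\in L$ in time polynomial in the length of the word. -/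

import Mathlib

/-! Strictly positive modal implications over a signature `R`, with propositional variables
indexed by `ℕ`: algebraic, syntactic and Kripke semantics, Horn-implications and their profiles. -/

namespace SPLogic

/-- Sp-formulas of signature `R`. -/
inductive Formula (R : Type) : Type
  | top : Formula R
  | var : ℕ → Formula R
  | and : Formula R → Formula R → Formula R
  | dia : R → Formula R → Formula R

/-- An sp-implication `lhs → rhs`. -/
structure Implication (R : Type) : Type where
  lhs : Formula R
  rhs : Formula R

variable {R : Type}

/-- Number of occurrences of variables, `⊤`, conjunctions and diamonds. -/
def Formula.size : Formula R → ℕ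
  | .top => 1
  | .var _ => 1
  | .and σ τ => σ.size + τ.size + 1
  | .dia _ σ => σ.size + 1

def Implication.size (ι : Implication R) : ℕ := ι.lhs.size + ι.rhs.size

/-- Simultaneous substitution of formulas for variables. -/
def Formula.subst (s : ℕ → Formula R) : Formula R → Formula R
  | .top => .top
  | .var p => s p
  | .and σ τ => .and (σ.subst s) (τ.subst s)
  | .dia r σ => .dia r (σ.subst s)

/-! ### Algebraic semantics -/

/-- Meet-semilattices with top and monotone operators, given by their equational axioms. -/
structure SLO (R : Type) : Type 1 where
  A : Type
  meet : A → A → A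
  top : A
  dia : R → A → A
  meet_idem : ∀ a, meet a a = a
  meet_comm : ∀ a b, meet a b = meet b a
  meet_assoc : ∀ a b c, meet a (meet b c) = meet (meet a b) c
  meet_top : ∀ a, meet a top = a
  dia_mono : ∀ r a b, meet (dia r (meet a b)) (dia r b) = dia r (meet a b)

/-- The value of a formula under a valuation. -/
def SLO.eval (𝔄 : SLO R) (a : ℕ → 𝔄.A) : Formula R → 𝔄.A
  | .top => 𝔄.top
  | .var p => a p
  | .and σ τ => 𝔄.meet (𝔄.eval a σ) (𝔄.eval a τ)
  | .dia r σ => 𝔄.dia r (𝔄.eval a σ)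

/-- The semilattice order. -/
def SLO.le (𝔄 : SLO R) (a b : 𝔄.A) : Prop := 𝔄.meet a b = a

/-- An SLO validates `σ → τ` if `σ[a] ≤ τ[a]` for all valuations `a`. -/
def SLO.Validates (𝔄 : SLO R) (ι : Implication R) : Prop :=
  ∀ a : ℕ → 𝔄.A, 𝔄.le (𝔄.eval a ι.lhs) (𝔄.eval a ι.rhs)

/-- `Ax ⊨_SLO ι`. -/
def SLOConsequence (Ax : Set (Implication R)) (ι : Implication R) : Prop :=
  ∀ 𝔄 : SLO R, (∀ κ ∈ Ax, 𝔄.Validates κ) → 𝔄.Validates ι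

/-! ### The calculus and spi-logics -/

/-- `Derivable Ax σ τ` means `Ax ⊢_SLO σ → τ`. -/
inductive Derivable (Ax : Set (Implication R)) : Formula R → Formula R → Prop
  | ax (ι : Implication R) (s : ℕ → Formula R) (h : ι ∈ Ax) :
      Derivable Ax (ι.lhs.subst s) (ι.rhs.subst s)
  | refl (σ : Formula R) : Derivable Ax σ σ
  | top (σ : Formula R) : Derivable Ax σ .top
  | and_comm (σ τ : Formula R) : Derivable Ax (.and σ τ) (.and τ σ)
  | and_left (σ τ : Formula R) : Derivable Ax (.and σ τ) σ
  | trans {σ τ ρ : Formula R} : Derivable Ax σ τ → Derivable Ax τ ρ → Derivable Ax σ ρ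
  | and_intro {σ τ ρ : Formula R} :
      Derivable Ax σ τ → Derivable Ax σ ρ → Derivable Ax σ (.and τ ρ)
  | dia (r : R) {σ τ : Formula R} : Derivable Ax σ τ → Derivable Ax (.dia r σ) (.dia r τ)

/-- The spi-logic `SPi + Ax` axiomatised by `Ax`. -/
def SPi (Ax : Set (Implication R)) : Set (Implication R) :=
  {ι | Derivable Ax ι.lhs ι.rhs}

/-! ### Kripke semantics -/

/-- Kripke frames of signature `R`. -/
structure Frame (R : Type) : Type 1 where
  W : Type
  nonempty : Nonempty W
  rel : R → W → W → Prop

/-- Truth of a formula at a point, in the model given by a frame and a valuation. -/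
def Frame.Sat (F : Frame R) (v : ℕ → Set F.W) : F.W → Formula R → Prop
  | _, .top => True
  | w, .var p => w ∈ v p
  | w, .and σ τ => F.Sat v w σ ∧ F.Sat v w τ
  | w, .dia r σ => ∃ w', F.rel r w w' ∧ F.Sat v w' σ

/-- `F ⊨ ι`. -/
def Frame.Validates (F : Frame R) (ι : Implication R) : Prop :=
  ∀ (v : ℕ → Set F.W) (w : F.W), F.Sat v w ι.lhs → F.Sat v w ι.rhs

/-- `F` is a frame for the set `L` of implications. -/
def Frame.IsFrameFor (F : Frame R) (L : Set (Implication R)) : Prop :=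
  ∀ κ ∈ L, F.Validates κ

/-- `Ax ⊨_Kr ι`. -/
def KrConsequence (Ax : Set (Implication R)) (ι : Implication R) : Prop :=
  ∀ F : Frame R, F.IsFrameFor Ax → F.Validates ι

/-- The spi-logic `SPi + Ax` is complete. -/
def IsComplete (Ax : Set (Implication R)) : Prop :=
  ∀ ι : Implication R, KrConsequence Ax ι ↔ SLOConsequence Ax ι

/-- Number of points plus number of labelled arrows of a frame. -/
noncomputable def Frame.size (F : Frame R) : ℕ∞ :=
  ENat.card F.W + ENat.card {e : R × F.W × F.W // F.rel e.1 e.2.1 e.2.2}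

/-- Every implication that fails in some frame for `L` fails in a frame for `L` whose size is
bounded by a polynomial, fixed for `L`, in the size of the implication. -/
def HasPolyFiniteFrameProperty (L : Set (Implication R)) : Prop :=
  ∃ P : Polynomial ℕ, ∀ ι : Implication R,
    (∃ F : Frame R, F.IsFrameFor L ∧ ¬ F.Validates ι) →
      ∃ F : Frame R, F.IsFrameFor L ∧ ¬ F.Validates ι ∧ F.size ≤ (P.eval ι.size : ℕ)

/-! ### The tree model of a formula -/

/-- The points of the tree of a formula other than the root. -/
def Formula.NonRoot : Formula R → Type
  | .top => Empty
  | .var _ => Empty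
  | .and σ τ => σ.NonRoot ⊕ τ.NonRoot
  | .dia _ σ => Option σ.NonRoot

/-- The points of the tree of a formula; the root is `none`. For `.and σ τ`, the trees of `σ` and
`τ` are embedded by `Option.map Sum.inl` and `Option.map Sum.inr`, which share the root only; for
`.dia r σ`, the tree of `σ` is embedded by `some` below a fresh root. -/
abbrev Formula.Point (σ : Formula R) : Type := Option σ.NonRoot

/-- The accessibility relations of the tree of a formula. -/
def Formula.treeRel : (σ : Formula R) → R → σ.Point → σ.Point → Prop
  | .top, _, _, _ => False
  | .var _, _, _, _ => False
  | .and σ τ, r, x, y =>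
      (∃ a b, x = Option.map Sum.inl a ∧ y = Option.map Sum.inl b ∧ σ.treeRel r a b) ∨
      (∃ a b, x = Option.map Sum.inr a ∧ y = Option.map Sum.inr b ∧ τ.treeRel r a b)
  | .dia s σ, r, x, y =>
      (r = s ∧ x = none ∧ y = some none) ∨
      (∃ a b : σ.Point, x = some a ∧ y = some b ∧ σ.treeRel r a b)

/-- The valuation of the tree model of a formula. -/
def Formula.treeVal : (σ : Formula R) → ℕ → Set σ.Point
  | .top, _ => ∅
  | .var p, q => {_x | q = p}
  | .and σ τ, p =>
      Option.map Sum.inl '' σ.treeVal p ∪ Option.map Sum.inr '' τ.treeVal p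
  | .dia _ σ, p => (some : σ.Point → Option σ.Point) '' σ.treeVal p

/-- The tree-shaped frame of a formula. -/
def Formula.tree (σ : Formula R) : Frame R where
  W := σ.Point
  nonempty := ⟨none⟩
  rel := σ.treeRel

/-! ### Profiles and Horn-implications -/

/-- A profile: a finite rooted frame `G` with a relation symbol `S` and points `u`, `v` such that
there is no `S`-arrow from `u` to `v`. -/
structure Profile (R : Type) : Type 1 where
  G : Frame R
  finite : Finite G.W
  rooted : ∃ x₀, ∀ x, Relation.ReflTransGen (fun y z => ∃ r, G.rel r y z) x₀ x
  S : R
  u : G.W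
  v : G.W
  not_rel : ¬ G.rel S u v

/-- `F` satisfies the universal Horn sentence of the profile: the universal closure of
`(conjunction of all R(x, y) with (x, y) an R-arrow of G) → S(u, v)`, with the points of `G` as
variables. -/
def Profile.Holds (π : Profile R) (F : Frame R) : Prop :=
  ∀ h : π.G.W → F.W, (∀ r x y, π.G.rel r x y → F.rel r (h x) (h y)) → F.rel π.S (h π.u) (h π.v)

/-- `π` is a profile of `ι`: the sentence of `π` is a correspondent of `ι`, i.e. it defines the
class of frames validating `ι`. -/
def Profile.IsProfileOf (π : Profile R) (ι : Implication R) : Prop :=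
  ∀ F : Frame R, F.Validates ι ↔ π.Holds F

/-- `ι` is a Horn-implication. -/
def IsHorn (ι : Implication R) : Prop := ∃ π : Profile R, π.IsProfileOf ι

/-- The closure of `F` under the set `P` of profiles: the smallest frame on the points of `F` that
contains the arrows of `F` and satisfies the sentences of all profiles in `P`, obtained as the
intersection of all such frames. -/
def Frame.closure (P : Set (Profile R)) (F : Frame R) : Frame R where
  W := F.W
  nonempty := F.nonempty
  rel r x y := ∀ rel' : R → F.W → F.W → Prop,
    (∀ s a b, F.rel s a b → rel' s a b) →
    (∀ π ∈ P, π.Holds ⟨F.W, F.nonempty, rel'⟩) → rel' r x y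

/-- The closure contains the arrows of `F` and satisfies the sentences of all profiles in `P`
(it is contained in any other such frame by definition). -/
theorem Frame.closure_spec (P : Set (Profile R)) (F : Frame R) :
    (∀ r x y, F.rel r x y → (F.closure P).rel r x y) ∧ ∀ π ∈ P, π.Holds (F.closure P) :=
  ⟨fun _ _ _ h _ h₁ _ => h₁ _ _ _ h,
    fun π hπ h hh rel' h₁ h₂ => h₂ π hπ h fun r x y hxy => hh r x y hxy rel' h₁ h₂⟩

/-! ### Decidability in polynomial time -/

/-- A finite alphabet for writing down sp-implications. -/
inductive Letter : Type
  | top | and | dia | var | sep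
  | bit : Bool → Letter

/-- Formulas as words in prefix notation, given names (bit strings) for the relation symbols and
the variables; every name is closed by the letter `sep`. -/
def Formula.encode (nr : R → List Bool) (nv : ℕ → List Bool) : Formula R → List Letter
  | .top => [.top]
  | .var p => .var :: (nv p).map .bit ++ [.sep]
  | .and σ τ => .and :: σ.encode nr nv ++ τ.encode nr nv
  | .dia r σ => .dia :: (nr r).map .bit ++ .sep :: σ.encode nr nv

/-- An implication `σ → τ` is written as the word of `σ` followed by the word of `τ`. -/
def Implication.encode (nr : R → List Bool) (nv : ℕ → List Bool) (ι : Implication R) :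
    List Letter :=
  ι.lhs.encode nr nv ++ ι.rhs.encode nr nv

/-- Some Turing machine, given the word of `a : α` as its input, outputs whether `a ∈ L` after a
number of steps bounded by a polynomial in the length of the word. -/
def DecidableInPTime {α Γ : Type} (enc : α → List Γ) (L : Set α) : Prop :=
  Nonempty (Turing.TM2ComputableInPolyTime enc Computability.encodeBool
    (fun a => @decide (a ∈ L) (Classical.propDecidable _)))

end SPLogic

/-! Sp-formulas are built without negation, disjunction or boxes, so homomorphisms of models
preserve them (`Frame.Sat.map`), and a point satisfies `σ` exactly when the tree model of `σ` maps
into the model with its root going to that point (`Formula.exists_hom`). Horn sentences pull back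
along maps: if `F` satisfies a profile, so do the relations induced on the tree by a map into `F`.
Hence any homomorphism from the tree of `σ` to a frame for the axioms is also one from the closure
of the tree. The closure is therefore the free model of the axioms in which `σ` holds at the root,
and it decides Kripke consequence (`krConsequence_iff`). It has at most `σ.size` points, and its
arrows carry only symbols from `σ` or from the conclusions of the profiles, which gives the
polynomial frame property (`hasPolyFiniteFrameProperty`).

For decidability, the Lindenbaum algebra identifies derivability with consequence over SLOs
(`mem_SPi_iff`), and completeness turns this into Kripke consequence. Parsing the word, building the
tree, closing it and evaluating the right formula are all expressed by one finite system of monotone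
rules `Rule`, deriving binary facts about positions of the word. Soundness (`closed_meaning`)
interprets the facts in an arbitrary model. For completeness (`acc_mem`), any set of facts closed
under the rules is itself read as a frame for the axioms.

It remains to saturate such a rule system on a Turing machine in polynomial time
(`Saturation.decidableInPTime`). A word of length `N` admits only `Nat.card P * N * N` facts and
polynomially many assignments of positions to the rule variables. The machine keeps a table with a
cell for each pair of positions and counts down through all assignments. Extra variables, which the
rules never use, act as a clock that repeats this enumeration often enough for one full round to add
nothing. -/

/-! ### Monotone rules on words, saturated by enumerating assignments -/

namespace Saturation

/-! ### Rule systems on the positions of a word -/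

/-- Atomic conditions on an assignment of positions of a word to the variables in `V`. -/
inductive Obs (A P V : Type) : Type
  | letter : A → V → Obs A P V
  | first : V → Obs A P V
  | succ : V → V → Obs A P V
  | fact : P → V → V → Obs A P V

/-- Truth of a condition in the word `w`, with the binary facts in `D`. -/
def Obs.Holds {A P V : Type} (w : List A) (D : Set (P × ℕ × ℕ)) (x : V → ℕ) : Obs A P V → Prop
  | .letter a i => w[x i]? = some a
  | .first i => x i = 0
  | .succ i j => x i + 1 = x j
  | .fact p i j => (p, x i, x j) ∈ D

/-- A rule system tells which facts `p(i, j)` follow from a set of conditions. -/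
abbrev Rules (A P V : Type) : Type := Set (Obs A P V) → P → V → V → Prop

variable {A P V : Type}

/-- The facts in `D` are closed under the rules. -/
def Closed (rules : Rules A P V) (w : List A) (D : Set (P × ℕ × ℕ)) : Prop :=
  ∀ x : V → ℕ, (∀ i, x i < w.length) → ∀ p i j,
    rules {o | o.Holds w D x} p i j → (p, x i, x j) ∈ D

/-- Facts added by the rules for one assignment. -/
def fire (rules : Rules A P V) (w : List A) (x : V → ℕ) (D : Set (P × ℕ × ℕ)) :
    Set (P × ℕ × ℕ) :=
  D ∪ {f | ∃ i j, x i = f.2.1 ∧ x j = f.2.2 ∧ rules {o | o.Holds w D x} f.1 i j}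

theorem Obs.Holds.mono {w : List A} {D D' : Set (P × ℕ × ℕ)} (h : D ⊆ D') (x : V → ℕ) :
    {o : Obs A P V | o.Holds w D x} ⊆ {o | o.Holds w D' x} := by
  rintro (_ | _ | _ | _) ho
  exacts [ho, ho, ho, h ho]

theorem subset_fire (rules : Rules A P V) (w : List A) (x : V → ℕ) (D : Set (P × ℕ × ℕ)) :
    D ⊆ fire rules w x D := Set.subset_union_left

theorem fire_subset_of_closed {rules : Rules A P V}
    (mono : ∀ O O' : Set (Obs A P V), O ⊆ O' → ∀ p i j, rules O p i j → rules O' p i j)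
    {w : List A} {D E : Set (P × ℕ × ℕ)} (hE : Closed rules w E) (h : D ⊆ E) {x : V → ℕ}
    (hx : ∀ i, x i < w.length) : fire rules w x D ⊆ E := by
  rintro ⟨p, a, b⟩ (hf | ⟨i, j, rfl, rfl, hr⟩)
  · exact h hf
  · exact hE x hx p i j (mono _ _ (Obs.Holds.mono h x) _ _ _ hr)

/-- The assignment given by the digits of `t` in base `N`. -/
def digit (N : ℕ) (M : ℕ) (t : ℕ) (i : Fin M) : ℕ := t / N ^ (i : ℕ) % N

/-- The facts known after `n` steps, in a run through all assignments that starts with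
assignment number `t₀` and proceeds downwards. -/
def facts {M : ℕ} (rules : Rules A P (Fin M)) (w : List A) (t₀ : ℕ) : ℕ → Set (P × ℕ × ℕ)
  | 0 => ∅
  | n + 1 => fire rules w (digit w.length M (t₀ - n)) (facts rules w t₀ n)

section Facts

variable {M : ℕ} (rules : Rules A P (Fin M)) (w : List A) (t₀ : ℕ)

theorem facts_mono : Monotone (facts rules w t₀) :=
  monotone_nat_of_le_succ fun _ => subset_fire rules w _ _

theorem digit_lt {N : ℕ} (hN : 0 < N) (M t : ℕ) (i : Fin M) : digit N M t i < N :=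
  Nat.mod_lt _ hN

theorem facts_subset
    (mono : ∀ O O' : Set (Obs A P (Fin M)), O ⊆ O' → ∀ p i j, rules O p i j → rules O' p i j)
    (hw : 0 < w.length) {E : Set (P × ℕ × ℕ)} (hE : Closed rules w E) (n : ℕ) :
    facts rules w t₀ n ⊆ E := by
  induction n with
  | zero => exact Set.empty_subset _
  | succ n ih => exact fire_subset_of_closed mono hE ih (digit_lt hw M _)

theorem facts_bounded (hw : 0 < w.length) (n : ℕ) :
    facts rules w t₀ n ⊆ Set.univ ×ˢ Set.Iio w.length ×ˢ Set.Iio w.length := by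
  induction n with
  | zero => exact Set.empty_subset _
  | succ n ih =>
    rintro ⟨p, a, b⟩ (hf | ⟨i, j, rfl, rfl, -⟩)
    · exact ih hf
    · exact ⟨trivial, digit_lt hw M _ _, digit_lt hw M _ _⟩

/-- A block of `N ^ m` consecutive numbers realises every choice of the `m` low digits. In the
induction the leading digit `x m` is absorbed into the block number `r`. -/
theorem exists_digits {N : ℕ} (m : ℕ) (x : ℕ → ℕ) (hx : ∀ i, x i < N) (r : ℕ) :
    ∃ s < N ^ m, ∀ i < m, (r * N ^ m + s) / N ^ i % N = x i := by
  induction m generalizing r with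
  | zero => exact ⟨0, by simp, by simp⟩
  | succ m ih =>
    have hN : 0 < N := (Nat.zero_le _).trans_lt (hx 0)
    obtain ⟨s, hs, h⟩ := ih (r * N + x m)
    have he : r * N ^ (m + 1) + (x m * N ^ m + s) = (r * N + x m) * N ^ m + s := by ring
    refine ⟨x m * N ^ m + s, ?_, fun i hi => ?_⟩
    · have h1 : (x m + 1) * N ^ m ≤ N * N ^ m := Nat.mul_le_mul_right _ (hx m)
      rw [pow_succ']; linarith
    · rw [he]
      rcases Nat.lt_succ_iff_lt_or_eq.1 hi with hi | rfl
      · exact h i hi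
      · rw [mul_comm, Nat.mul_add_div (by positivity), Nat.div_eq_of_lt hs, add_zero,
          mul_comm, Nat.mul_add_mod, Nat.mod_eq_of_lt (hx _)]

/-- If the rules use the first `m` variables only, and there are enough other variables, then
all facts are found. -/
theorem acc_mem_facts [Finite P] {m : ℕ}
    (mono : ∀ O O' : Set (Obs A P (Fin M)), O ⊆ O' → ∀ p i j, rules O p i j → rules O' p i j)
    (hM : M = m + (Nat.card P + 3)) (hw : 2 ≤ w.length)
    (dep : ∀ D : Set (P × ℕ × ℕ), ∀ x y : Fin M → ℕ, (∀ i : Fin M, (i : ℕ) < m → x i = y i) →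
      ∀ p i j, rules {o | o.Holds w D x} p i j → (i : ℕ) < m ∧ (j : ℕ) < m ∧
        rules {o | o.Holds w D y} p i j)
    (f : P × ℕ × ℕ) :
    f ∈ facts rules w (w.length ^ M - 1) (w.length ^ M - 1) ↔ ∀ D, Closed rules w D → f ∈ D := by
  set N := w.length with hNdef
  set t₀ := N ^ M - 1 with ht₀
  set q := N ^ (Nat.card P + 3) with hq
  have hN0 : 0 < N := by omega
  have hqM : N ^ M = q * N ^ m := by rw [hM, pow_add, mul_comm]
  have hpm : 0 < N ^ m := by positivity
  refine ⟨fun h D hD => facts_subset rules w t₀ mono hN0 hD _ h, fun h => ?_⟩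
  -- The enumeration consists of `q` rounds of `N ^ m` assignments, each round exhausting the
  -- variables used by the rules. Two factors of `N` in `q` account for the pairs of positions; the
  -- other `Nat.card P + 1` factors, each at least `2`, exceed the number of predicates. The spare
  -- round is needed because `t₀` steps never treat assignment `0`, so only `q - 1` rounds are
  -- complete.
  have hbig : Nat.card P * (N * N) + 1 < q := by
    have h1 : Nat.card P + 2 ≤ 2 ^ (Nat.card P + 1) := Nat.lt_two_pow_self
    have h2 : 2 ^ (Nat.card P + 1) ≤ N ^ (Nat.card P + 1) := Nat.pow_le_pow_left hw _
    have h3 : q = N ^ (Nat.card P + 1) * (N * N) := by rw [hq]; ring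
    rw [h3]
    nlinarith [Nat.mul_le_mul_right (N * N) (h1.trans h2), Nat.mul_le_mul hw hw]
  -- some round adds nothing
  have hround : ∃ ρ < q - 1, facts rules w t₀ (ρ * N ^ m) = facts rules w t₀ ((ρ + 1) * N ^ m) := by
    by_contra! hne
    have hfin : (Set.univ ×ˢ Set.Iio N ×ˢ Set.Iio N : Set (P × ℕ × ℕ)).Finite :=
      Set.finite_univ.prod ((Set.finite_Iio N).prod (Set.finite_Iio N))
    have hcard : ∀ ρ ≤ q - 1, ρ ≤ (facts rules w t₀ (ρ * N ^ m)).ncard := by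
      intro ρ
      induction ρ with
      | zero => intro _; exact Nat.zero_le _
      | succ ρ ih =>
        intro hρ
        refine (Nat.succ_le_succ (ih (by omega))).trans (Nat.succ_le_of_lt ?_)
        refine Set.ncard_lt_ncard (lt_of_le_of_ne ?_ (hne ρ (by omega)))
          (hfin.subset (facts_bounded rules w t₀ hN0 _))
        exact facts_mono rules w t₀ (Nat.mul_le_mul_right _ (Nat.le_succ _))
    have h1 := hcard (q - 1) le_rfl
    have h2 := Set.ncard_le_ncard (facts_bounded rules w t₀ hN0 ((q - 1) * N ^ m)) hfin
    rw [Set.ncard_prod, Set.ncard_prod, Set.ncard_univ, ← hNdef, Set.ncard_Iio_nat] at h2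
    omega
  obtain ⟨ρ, hρ, heq⟩ := hround
  have hconst : ∀ s ≤ N ^ m, facts rules w t₀ (ρ * N ^ m + s) = facts rules w t₀ (ρ * N ^ m) := by
    intro s hs
    refine Set.Subset.antisymm ?_ (facts_mono rules w t₀ (Nat.le_add_right _ _))
    rw [heq]
    exact facts_mono rules w t₀ (by rw [add_mul, one_mul]; omega)
  have hlast : (ρ + 1) * N ^ m ≤ t₀ := by
    have h1 : (ρ + 1) * N ^ m ≤ (q - 1) * N ^ m := Nat.mul_le_mul_right _ (by omega)
    rw [Nat.sub_mul, one_mul] at h1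
    have h2 : N ^ m ≤ q * N ^ m := Nat.le_mul_of_pos_left _ (by omega)
    omega
  have hclosed : Closed rules w (facts rules w t₀ (ρ * N ^ m)) := by
    intro x hx p i j hr
    obtain ⟨s, hs, hdig⟩ := exists_digits (N := N) m
      (fun i => if h : i < M then x ⟨i, h⟩ else 0)
      (fun i => by split_ifs; exacts [hx _, hN0]) (q - 1 - ρ)
    have hx' : ∀ i : Fin M, (i : ℕ) < m → x i = digit N M ((q - 1 - ρ) * N ^ m + s) i := by
      intro i hi
      have := hdig i hi
      rw [dif_pos i.2] at this
      exact this.symm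
    -- The count runs downwards, so round `ρ` treats block `q - 1 - ρ`, and number `s` of that block
    -- comes up at step `N ^ m - 1 - s` of the round.
    have hn : t₀ - (ρ * N ^ m + (N ^ m - 1 - s)) = (q - 1 - ρ) * N ^ m + s := by
      have h1 : q * N ^ m = (q - 1 - ρ) * N ^ m + N ^ m + ρ * N ^ m := by
        rw [← Nat.succ_mul, ← add_mul]; congr 1; omega
      omega
    obtain ⟨hi, hj, hr'⟩ := dep _ _ _ hx' p i j hr
    rw [← hconst (N ^ m - 1 - s + 1) (by omega), ← add_assoc, facts, hconst _ (by omega)]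
    refine Or.inr ⟨i, j, ?_, ?_, ?_⟩
    · simp only; rw [hn]; exact (hx' i hi).symm
    · simp only; rw [hn]; exact (hx' j hj).symm
    · simp only; rw [hn]; exact hr'
  refine facts_mono rules w t₀ (?_ : ρ * N ^ m ≤ t₀) (h _ hclosed)
  rw [add_mul] at hlast; omega

end Facts

end Saturation

/-! ### The stack machine and the runs of its phases -/

namespace Saturation

variable {A P : Type} {M : ℕ}

/-! ### The machine -/

/-- A cell of the table: it belongs to a pair of positions, and carries the letter at the second
position, whether the second position is the first one of the word, the variables whose value is
the first (second) position, and the known facts about the pair. -/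
structure Cell (A P : Type) (M : ℕ) : Type where
  ltr : A
  fst : Prop
  rowMarks : Set (Fin M)
  colMarks : Set (Fin M)
  facts : Set P

/-- The finite memory of the machine. -/
structure Memory (A P : Type) (M : ℕ) : Type where
  ltr : Option A
  cell : Option (Cell A P M)
  obs : Set (Obs A P (Fin M))
  prev : Set (Fin M)
  carry : Set (Fin M)
  cur : Set (Fin M)
  fst : Prop

/-- `word` and `count` hold the word in reverse, the latter only as a unary counter of rows. The
table lies on `table` and `back`, the parts of it after and before the scanned cell. -/
inductive Stack : Type
  | input | count | word | table | back | output
  deriving DecidableEq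

/-- `load`, `row`, `cells` and `restore` build the table from its last cell backwards. `collect` and
`update` are the two sweeps carried out for each assignment. `clean` empties the stacks and writes
the answer. -/
inductive Label : Type
  | load | row | cells | restore | collect | update | clean
  deriving DecidableEq

instance : Fintype Stack :=
  ⟨{.input, .count, .word, .table, .back, .output}, fun s => by cases s <;> simp⟩

instance : Fintype Label :=
  ⟨{.load, .row, .cells, .restore, .collect, .update, .clean}, fun s => by cases s <;> simp⟩

instance [Finite A] [Finite P] {V : Type} [Finite V] : Finite (Obs A P V) :=
  Finite.of_injective
    (β := (A × V) ⊕ V ⊕ (V × V) ⊕ (P × V × V))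
    (fun
      | .letter a i => .inl (a, i)
      | .first i => .inr (.inl i)
      | .succ i j => .inr (.inr (.inl (i, j)))
      | .fact p i j => .inr (.inr (.inr (p, i, j))))
    (fun a b h => by cases a <;> cases b <;> simp_all)

instance [Finite A] [Finite P] : Finite (Cell A P M) :=
  Finite.of_injective (fun c => (c.ltr, c.fst, c.rowMarks, c.colMarks, c.facts))
    (fun a b h => by cases a; cases b; simp_all)

instance [Finite A] [Finite P] : Finite (Memory A P M) :=
  Finite.of_injective (fun c => (c.ltr, c.cell, c.obs, c.prev, c.carry, c.cur, c.fst))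
    (fun a b h => by cases a; cases b; simp_all)

instance [Inhabited A] : Inhabited (Cell A P M) := ⟨⟨default, False, ∅, ∅, ∅⟩⟩

/-- The alphabets of the contents. -/
@[reducible] def Alphabet (A P : Type) (M : ℕ) : Stack → Type
  | .input => A
  | .count => A
  | .word => A
  | .table => Cell A P M
  | .back => Cell A P M
  | .output => Bool

/-- The memory at the start and at the end. -/
def Memory.init : Memory A P M := ⟨none, none, ∅, ∅, ∅, ∅, False⟩

/-- The conditions witnessed by a cell, given the column marks of the preceding cell. -/
def Cell.obs (prev : Set (Fin M)) (c : Cell A P M) : Set (Obs A P (Fin M))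
  | .letter a i => i ∈ c.colMarks ∧ c.ltr = a
  | .first i => i ∈ c.colMarks ∧ c.fst
  | .succ i j => ¬ c.fst ∧ i ∈ prev ∧ j ∈ c.colMarks
  | .fact p i j => i ∈ c.rowMarks ∧ j ∈ c.colMarks ∧ p ∈ c.facts

/-- Reading a cell in a forward sweep. -/
def Memory.collect (s : Memory A P M) (c : Cell A P M) : Memory A P M :=
  { s with cell := some c, obs := s.obs ∪ c.obs s.prev, prev := c.colMarks }

/-- The variables observed to have the value `0`. -/
def Memory.zeros (s : Memory A P M) : Set (Fin M) := {i | Obs.first i ∈ s.obs}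

/-- Change the marks of those variables for which all variables with a lower number are `0`. -/
def Memory.decr (s : Memory A P M) (new old : Set (Fin M)) : Set (Fin M) :=
  {i | ((∀ j < i, j ∈ s.zeros) ∧ i ∈ new) ∨ ((¬ ∀ j < i, j ∈ s.zeros) ∧ i ∈ old)}

/-- Updating a cell in a backward sweep: facts are added, and the assignment is decremented. -/
def Memory.update (rules : Rules A P (Fin M)) (s : Memory A P M) (c : Cell A P M) :
    Memory A P M :=
  let carry : Set (Fin M) := {i | (s.fst ∧ i ∈ s.cur) ∨ (¬ s.fst ∧ i ∈ s.carry)}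
  { s with
    cell := some
      { ltr := c.ltr
        fst := c.fst
        rowMarks := s.decr carry c.rowMarks
        colMarks := s.decr s.prev c.colMarks
        facts := c.facts ∪ {p | ∃ i j, i ∈ c.rowMarks ∧ j ∈ c.colMarks ∧ rules s.obs p i j} }
    prev := c.colMarks
    carry := carry
    cur := c.rowMarks
    fst := c.fst }

open Turing.TM2.Stmt in
open scoped Classical in
/-- The program of the machine. -/
noncomputable def program [Inhabited A] (rules : Rules A P (Fin M)) (acc : P) :
    Label → Turing.TM2.Stmt (Alphabet A P M) Label (Memory A P M)
  | .load =>
    pop .input (fun s o => { s with ltr := o }) <|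
    branch (fun s => s.ltr.isNone)
      -- The first assignment gives every variable the last position, so the row marks all lie in
      -- the row that is built first.
      (load (fun s => { s with carry := Set.univ }) <| goto fun _ => .row)
      (push .count (fun s => s.ltr.getD default) <|
        push .word (fun s => s.ltr.getD default) <| goto fun _ => .load)
  | .row =>
    pop .count (fun s o => { s with ltr := o }) <|
    branch (fun s => s.ltr.isNone)
      (load (fun _ => Memory.init) <| goto fun _ => .collect)
      (load (fun s => { s with prev := Set.univ }) <| goto fun _ => .cells)
  | .cells =>
    pop .word (fun s o => { s with ltr := o }) <|
    branch (fun s => s.ltr.isNone)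
      (load (fun s => { s with carry := ∅ }) <| goto fun _ => .restore)
      (peek .word (fun s o => { s with fst := o = none }) <|
        push .input (fun s => s.ltr.getD default) <|
        push .table (fun s => ⟨s.ltr.getD default, s.fst, s.carry, s.prev, ∅⟩) <|
        load (fun s => { s with prev := ∅ }) <| goto fun _ => .cells)
  | .restore =>
    pop .input (fun s o => { s with ltr := o }) <|
    branch (fun s => s.ltr.isNone)
      (goto fun _ => .row)
      (push .word (fun s => s.ltr.getD default) <| goto fun _ => .restore)
  | .collect =>
    pop .table (fun s o => o.elim { s with cell := none } s.collect) <|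
    branch (fun s => s.cell.isNone)
      -- The backward sweep treats the table cyclically: the cell following the last one is cell
      -- `0`, which starts a row and whose row and column marks are the variables with value `0`.
      (load (fun s => { s with fst := True, cur := s.zeros, prev := s.zeros }) <|
        goto fun _ => .update)
      (push .back (fun s => s.cell.getD default) <| goto fun _ => .collect)
  | .update =>
    pop .back (fun s o => o.elim { s with cell := none } (s.update rules)) <|
    branch (fun s => s.cell.isNone)
      (branch (fun s => decide (s.zeros = Set.univ))
        (goto fun _ => .clean)
        (load (fun _ => Memory.init) <| goto fun _ => .collect))
      (push .table (fun s => s.cell.getD default) <| goto fun _ => .update)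
  | .clean =>
    pop .word (fun s o => { s with ltr := o }) <|
    pop .table (fun s o => { s with cell := o }) <|
    branch (fun s => s.ltr.isNone && s.cell.isNone)
      -- The observations left over come from the pass in which all variables are `0`, so a fact
      -- about any `i`, `i` is a fact about the positions `0`, `0`.
      (push .output (fun s => decide (∃ i, Obs.fact acc i i ∈ s.obs)) <|
        load (fun _ => Memory.init) halt)
      (goto fun _ => .clean)

/-- The machine that saturates a table of facts. -/
noncomputable def machine [Inhabited A] [Finite A] [Finite P] (rules : Rules A P (Fin M)) (acc : P) :
    Turing.FinTM2 :=
  letI := Fintype.ofFinite (Memory A P M)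
  letI : Fintype (Alphabet A P M .input) := Fintype.ofFinite A
  { k₀ := Stack.input
    k₁ := Stack.output
    Γ := Alphabet A P M
    Λ := Label
    main := .load
    σ := Memory A P M
    initialState := Memory.init
    m := program rules acc }

/-- The contents of all stacks. -/
def contents (i a b : List A) (t u : List (Cell A P M)) (o : List Bool) :
    ∀ k, List (Alphabet A P M k)
  | .input => i
  | .count => a
  | .word => b
  | .table => t
  | .back => u
  | .output => o

section Stacks

variable (i a b l : List A) (t u m : List (Cell A P M)) (o n : List Bool)

@[simp] theorem stacks_input : contents i a b t u o .input = i := rfl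
@[simp] theorem stacks_count : contents i a b t u o .count = a := rfl
@[simp] theorem stacks_word : contents i a b t u o .word = b := rfl
@[simp] theorem stacks_table : contents i a b t u o .table = t := rfl
@[simp] theorem stacks_back : contents i a b t u o .back = u := rfl
@[simp] theorem stacks_output : contents i a b t u o .output = o := rfl

@[simp] theorem update_input :
    Function.update (contents i a b t u o) .input l = contents l a b t u o := by
  funext k; cases k <;> simp [Function.update, contents]

@[simp] theorem update_count :
    Function.update (contents i a b t u o) .count l = contents i l b t u o := by
  funext k; cases k <;> simp [Function.update, contents]

@[simp] theorem update_word :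
    Function.update (contents i a b t u o) .word l = contents i a l t u o := by
  funext k; cases k <;> simp [Function.update, contents]

@[simp] theorem update_table :
    Function.update (contents i a b t u o) .table m = contents i a b m u o := by
  funext k; cases k <;> simp [Function.update, contents]

@[simp] theorem update_back :
    Function.update (contents i a b t u o) .back m = contents i a b t m o := by
  funext k; cases k <;> simp [Function.update, contents]

@[simp] theorem update_output :
    Function.update (contents i a b t u o) .output n = contents i a b t u n := by
  funext k; cases k <;> simp [Function.update, contents]

end Stacks

/-! ### Runs of the machine -/

section Runs

variable [Inhabited A] (rules : Rules A P (Fin M)) (acc : P)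

/-- The program leads from one configuration to another in at most `n` steps. -/
def Runs (n : ℕ) (c c' : Turing.TM2.Cfg (Alphabet A P M) Label (Memory A P M)) : Prop :=
  ∃ k ≤ n, (flip bind (Turing.TM2.step (program rules acc)))^[k] (some c) = some c'

variable {rules acc}

theorem Runs.refl (c) : Runs rules acc 0 c c := ⟨0, le_rfl, rfl⟩

theorem Runs.mono {n n' : ℕ} {c c'} (h : Runs rules acc n c c') (hn : n ≤ n') :
    Runs rules acc n' c c' := by
  obtain ⟨k, hk, h⟩ := h
  exact ⟨k, hk.trans hn, h⟩

theorem Runs.trans {n n' : ℕ} {c c' c''} (h : Runs rules acc n c c')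
    (h' : Runs rules acc n' c' c'') : Runs rules acc (n + n') c c'' := by
  obtain ⟨k, hk, h⟩ := h
  obtain ⟨k', hk', h'⟩ := h'
  exact ⟨k' + k, by omega, by rw [Function.iterate_add_apply, h, h']⟩

theorem Runs.step {l : Label} {s : Memory A P M} {S} {c'}
    (h : Turing.TM2.stepAux (program rules acc l) s S = c') :
    Runs rules acc 1 ⟨some l, s, S⟩ c' :=
  ⟨1, le_rfl, by subst h; rfl⟩

theorem Runs.head {n : ℕ} {l : Label} {s : Memory A P M} {S} {c' c''}
    (h : Turing.TM2.stepAux (program rules acc l) s S = c') (h' : Runs rules acc n c' c'') :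
    Runs rules acc (n + 1) ⟨some l, s, S⟩ c'' := by
  rw [add_comm]; exact (Runs.step h).trans h'

theorem runs_load (i a b : List A) (s : Memory A P M) :
    Runs rules acc (i.length + 1) ⟨some .load, s, contents i a b [] [] []⟩
      ⟨some .row, { s with ltr := none, carry := Set.univ },
        contents [] (i.reverse ++ a) (i.reverse ++ b) [] [] []⟩ := by
  induction i generalizing a b s with
  | nil => exact Runs.step (by simp [program])
  | cons x i ih =>
    refine Runs.head (c' := ⟨some .load, { s with ltr := some x },
      contents i (x :: a) (x :: b) [] [] []⟩) (by simp [program]) ?_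
    simpa using ih (x :: a) (x :: b) { s with ltr := some x }

theorem runs_restore (i a b : List A) (t : List (Cell A P M)) (s : Memory A P M) :
    Runs rules acc (i.length + 1) ⟨some .restore, s, contents i a b t [] []⟩
      ⟨some .row, { s with ltr := none }, contents [] a (i.reverse ++ b) t [] []⟩ := by
  induction i generalizing b s with
  | nil => exact Runs.step (by simp [program])
  | cons x i ih =>
    refine Runs.head (c' := ⟨some .restore, { s with ltr := some x },
      contents i a (x :: b) t [] []⟩) (by simp [program]) ?_
    simpa using ih (x :: b) { s with ltr := some x }

/-- The cells of a row of the table, in reverse order. -/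
def rowCells (carry : Set (Fin M)) : Set (Fin M) → List A → List (Cell A P M)
  | _, [] => []
  | prev, x :: b => ⟨x, b = [], carry, prev, ∅⟩ :: rowCells carry ∅ b

theorem runs_cells (i a b : List A) (t : List (Cell A P M)) (s : Memory A P M) :
    ∃ p f, Runs rules acc (b.length + 1) ⟨some .cells, s, contents i a b t [] []⟩
      ⟨some .restore, { s with ltr := none, carry := ∅, prev := p, fst := f },
        contents (b.reverse ++ i) a [] ((rowCells s.carry s.prev b).reverse ++ t) [] []⟩ := by
  induction b generalizing i t s with
  | nil => exact ⟨s.prev, s.fst, Runs.step (by simp [program, rowCells])⟩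
  | cons x b ih =>
    obtain ⟨p, f, h⟩ := ih (x :: i) (⟨x, b = [], s.carry, s.prev, ∅⟩ :: t)
      { s with ltr := some x, prev := ∅, fst := b = [] }
    refine ⟨p, f, Runs.head (c' := ⟨some .cells, { s with ltr := some x, prev := ∅, fst := b = [] },
      contents (x :: i) a b (⟨x, b = [], s.carry, s.prev, ∅⟩ :: t) [] []⟩) ?_ ?_⟩
    · simp [program]
    · simpa [rowCells] using h

theorem runs_collect (b : List A) (t u : List (Cell A P M)) (s : Memory A P M) :
    Runs rules acc (t.length + 1) ⟨some .collect, s, contents [] [] b t u []⟩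
      ⟨some .update, { t.foldl Memory.collect s with
          cell := none, fst := True, cur := (t.foldl Memory.collect s).zeros,
          prev := (t.foldl Memory.collect s).zeros },
        contents [] [] b [] (t.reverse ++ u) []⟩ := by
  induction t generalizing u s with
  | nil => exact Runs.step (by simp [program, Memory.zeros])
  | cons c t ih =>
    refine Runs.head (c' := ⟨some .collect, s.collect c, contents [] [] b t (c :: u) []⟩)
      (by simp [program, Memory.collect]) ?_
    simpa using ih (c :: u) (s.collect c)

/-- The effect of a backward sweep over the cells in the list. -/
def sweep (rules : Rules A P (Fin M)) :
    Memory A P M → List (Cell A P M) → List (Cell A P M) → Memory A P M × List (Cell A P M)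
  | s, [], t => (s, t)
  | s, c :: u, t => sweep rules (s.update rules c) u ((s.update rules c).cell.getD default :: t)

theorem runs_update (b : List A) (t u : List (Cell A P M)) (s : Memory A P M) {c'}
    (h : Turing.TM2.stepAux (program rules acc .update) (sweep rules s u t).1
      (contents [] [] b (sweep rules s u t).2 [] []) = c') :
    Runs rules acc (u.length + 1) ⟨some .update, s, contents [] [] b t u []⟩ c' := by
  induction u generalizing t s with
  | nil => exact Runs.step h
  | cons c u ih =>
    refine Runs.head (c' := ⟨some .update, s.update rules c,
      contents [] [] b ((s.update rules c).cell.getD default :: t) u []⟩)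
      (by simp [program, Memory.update]) ?_
    exact ih _ _ h

open scoped Classical in
theorem runs_clean (b : List A) (t : List (Cell A P M)) (s : Memory A P M) :
    Runs rules acc (b.length + t.length + 1) ⟨some .clean, s, contents [] [] b t [] []⟩
      ⟨none, Memory.init, contents [] [] [] [] [] [decide (∃ i, Obs.fact acc i i ∈ s.obs)]⟩ := by
  induction hn : b.length + t.length using Nat.strong_induction_on generalizing b t s with
  | _ n ih =>
    subst hn
    by_cases h : b = [] ∧ t = []
    · obtain ⟨rfl, rfl⟩ := h
      exact (Runs.step (by simp [program])).mono (by simp)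
    · have hlt : b.tail.length + t.tail.length < b.length + t.length := by
        rcases b with _ | ⟨x, b⟩ <;> rcases t with _ | ⟨c, t⟩ <;> simp_all
        omega
      refine (Runs.head (c' := ⟨some .clean, { s with ltr := b.head?, cell := t.head? },
        contents [] [] b.tail t.tail [] []⟩) ?_ (ih _ hlt b.tail t.tail _ rfl)).mono (by omega)
      rcases b with _ | ⟨x, b⟩ <;> rcases t with _ | ⟨c, t⟩ <;> simp_all [program]

end Runs

end Saturation

/-! ### Counting down in base `N`, and the effect of sweeps on the table -/

namespace Saturation

variable {A P : Type} {M : ℕ}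

/-! ### Decrementing assignments -/

open scoped Classical in
/-- The next assignment: variables are decremented if all preceding ones are `0`. -/
noncomputable def pred (N : ℕ) (x : Fin M → ℕ) (i : Fin M) : ℕ :=
  if ∀ j < i, x j = 0 then (x i + (N - 1)) % N else x i

/-- The cyclic decrement seen from the target: a mark that arrives at `b` comes from the position
after `b`. A backward sweep has just read that position, so marks can be moved with finite memory.
-/
theorem pred_step {N a b : ℕ} (ha : a < N) (hb : b < N) :
    (a + (N - 1)) % N = b ↔ a = (b + 1) % N := by
  rcases Nat.eq_zero_or_pos a with rfl | h
  · rw [zero_add, Nat.mod_eq_of_lt (by omega)]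
    rcases Nat.lt_or_ge (b + 1) N with h1 | h1
    · rw [Nat.mod_eq_of_lt h1]; omega
    · rw [show b + 1 = N by omega, Nat.mod_self]; omega
  · rw [show a + (N - 1) = a - 1 + N by omega, Nat.add_mod_right, Nat.mod_eq_of_lt (by omega)]
    rcases Nat.lt_or_ge (b + 1) N with h1 | h1
    · rw [Nat.mod_eq_of_lt h1]; omega
    · rw [show b + 1 = N by omega, Nat.mod_self]; omega

theorem decr_eq {N : ℕ} {x : Fin M → ℕ} (hx : ∀ i, x i < N) {b : ℕ} (hb : b < N)
    {s : Memory A P M} (hs : s.zeros = {i | x i = 0}) :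
    s.decr {i | x i = (b + 1) % N} {i | x i = b} = {i | pred N x i = b} := by
  ext i
  simp only [Memory.decr, hs, Set.mem_ofPred_eq, pred]
  split_ifs with h
  · rw [pred_step (hx i) hb]; tauto
  · tauto

theorem digit_top {N : ℕ} (hN : 0 < N) (i : Fin M) : digit N M (N ^ M - 1) i = N - 1 := by
  obtain ⟨d, hd⟩ : ∃ d, M = i + (d + 1) := ⟨M - i - 1, by omega⟩
  have hp : 0 < N ^ (i : ℕ) := by positivity
  have hq : 0 < N ^ d := by positivity
  have h : N ^ M - 1 = N ^ (i : ℕ) * (N * (N ^ d - 1) + (N - 1)) + (N ^ (i : ℕ) - 1) := by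
    have h1 : N * (N ^ d - 1) + N = N * N ^ d := by
      rw [← Nat.mul_succ]; congr 1; omega
    have h2 : N ^ M = N ^ (i : ℕ) * (N * (N ^ d - 1) + (N - 1)) + N ^ (i : ℕ) := by
      rw [← Nat.mul_succ, Nat.succ_eq_add_one, add_assoc, Nat.sub_add_cancel hN, h1]
      conv_lhs => rw [hd]
      ring
    omega
  rw [digit, h, Nat.mul_add_div hp, Nat.div_eq_of_lt (by omega), add_zero, Nat.mul_add_mod,
    Nat.mod_eq_of_lt (by omega)]

theorem digits_eq_zero_iff {N : ℕ} (t i : ℕ) (hi : i ≤ M) :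
    (∀ j : Fin M, (j : ℕ) < i → digit N M t j = 0) ↔ N ^ i ∣ t := by
  induction i with
  | zero => simp
  | succ i ih =>
    constructor
    · intro h
      have h1 : N ^ i ∣ t := (ih (by omega)).1 fun j hj => h j (by omega)
      have h2 : t / N ^ i % N = 0 := h ⟨i, by omega⟩ (by simp)
      obtain ⟨u, rfl⟩ := h1
      rcases Nat.eq_zero_or_pos (N ^ i) with h0 | h0
      · simp [h0]
      · rw [Nat.mul_div_cancel_left _ h0] at h2
        rw [pow_succ]
        exact Nat.mul_dvd_mul_left _ (Nat.dvd_of_mod_eq_zero h2)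
    · rintro h j hj
      have h1 : N ^ (j + 1 : ℕ) ∣ t := (pow_dvd_pow N hj).trans h
      obtain ⟨u, rfl⟩ := h1
      rcases Nat.eq_zero_or_pos (N ^ (j : ℕ)) with h0 | h0
      · simp [digit, h0]
      · rw [digit, pow_succ, mul_assoc, Nat.mul_div_cancel_left _ h0, Nat.mul_mod_right]

/-- Passing from `t + 1` to `t`, the borrow reaches digit `i` exactly when all lower digits of `t +
1` vanish, that is, when `N ^ i` divides `t + 1`; this is also the case distinction of
`Nat.succ_div`. -/
theorem digit_pred {N : ℕ} (hN : 0 < N) {t : ℕ} :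
    pred N (digit N M (t + 1)) = digit N M t := by
  funext i
  have h : (∀ j < i, digit N M (t + 1) j = 0) ↔ N ^ (i : ℕ) ∣ t + 1 :=
    digits_eq_zero_iff (t + 1) i i.2.le
  rw [pred]
  split_ifs with h1
  · rw [pred_step (digit_lt hN _ _ _) (digit_lt hN _ _ _)]
    simp only [digit, Nat.succ_div, if_pos (h.1 h1)]
    simp
  · simp only [digit, Nat.succ_div, if_neg (fun h2 => h1 (h.2 h2))]
    simp

theorem digits_eq_zero {N t : ℕ} (ht : t < N ^ M) : (∀ i, digit N M t i = 0) ↔ t = 0 := by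
  constructor
  · intro h
    exact Nat.eq_zero_of_dvd_of_lt ((digits_eq_zero_iff t M le_rfl).1 fun j _ => h j) ht
  · rintro rfl i; simp [digit]

section Tables

variable [Inhabited A]

/-! ### The table -/

/-- The cell number `k` of the table for an assignment and a set of facts. -/
def cellAt (w : List A) (x : Fin M → ℕ) (D : Set (P × ℕ × ℕ)) (k : ℕ) : Cell A P M where
  ltr := w.getD (k % w.length) default
  fst := k % w.length = 0
  rowMarks := {i | x i = k / w.length}
  colMarks := {i | x i = k % w.length}
  facts := {p | (p, k / w.length, k % w.length) ∈ D}

/-- The table for an assignment and a set of facts. -/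
def tape (w : List A) (x : Fin M → ℕ) (D : Set (P × ℕ × ℕ)) : List (Cell A P M) :=
  (List.range (w.length * w.length)).map (cellAt w x D)

theorem length_tape (w : List A) (x : Fin M → ℕ) (D : Set (P × ℕ × ℕ)) :
    (tape w x D).length = w.length * w.length := by simp [tape]

open scoped Classical in
theorem reverse_rowCells (carry prev : Set (Fin M)) (l : List A) :
    (rowCells (P := P) carry prev l.reverse).reverse = (List.range l.length).map fun b =>
      ⟨l.getD b default, b = 0, carry, if b + 1 = l.length then prev else ∅, ∅⟩ := by
  induction l using List.reverseRecOn generalizing prev with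
  | nil => simp [rowCells]
  | append_singleton l x ih =>
    simp only [List.reverse_append, List.reverse_cons, List.reverse_nil, List.nil_append,
      List.singleton_append, rowCells, ih, List.length_append, List.length_singleton,
      List.range_succ, List.map_append, List.map_cons, List.map_nil]
    congr 1
    · refine List.map_congr_left fun b hb => ?_
      have hb := List.mem_range.1 hb
      simp [hb, hb.ne, List.getElem?_append_left]
    · simp

section Build

variable {rules : Rules A P (Fin M)} {acc : P}

theorem row_eq (w : List A) (r : ℕ) (hr : r < w.length) :
    (rowCells (P := P) (M := M) {_i | r + 1 = w.length} Set.univ w.reverse).reverse =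
      (List.range w.length).map fun b => cellAt w (fun _ => w.length - 1) ∅ (r * w.length + b) := by
  rw [reverse_rowCells]
  refine List.map_congr_left fun b hb => ?_
  have hb := List.mem_range.1 hb
  have h1 : (r * w.length + b) % w.length = b := by
    rw [mul_comm, Nat.mul_add_mod, Nat.mod_eq_of_lt hb]
  have h2 : (r * w.length + b) / w.length = r := by
    rw [mul_comm, Nat.mul_add_div (by omega), Nat.div_eq_of_lt hb, add_zero]
  simp only [cellAt, h1, h2, Cell.mk.injEq, true_and]
  refine ⟨?_, ?_, ?_⟩
  · ext i; simp only [Set.mem_ofPred_eq]; omega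
  · ext i
    split_ifs with h
    · simp only [Set.mem_univ, Set.mem_ofPred_eq, true_iff]; omega
    · simp only [Set.mem_empty_iff_false, Set.mem_ofPred_eq, false_iff]; omega
  · ext; simp

theorem runs_row (w : List A) (a : List A) (t : List (Cell A P M)) (s : Memory A P M)
    (hs : s.carry = {_i | a.length = w.length}) (ha : a.length ≤ w.length)
    (ht : (List.range (a.length * w.length)).map (cellAt w (fun _ => w.length - 1) ∅) ++ t =
      tape w (fun _ => w.length - 1) ∅) :
    Runs rules acc (a.length * (2 * w.length + 3) + 1)
      ⟨some .row, s, contents [] a w.reverse t [] []⟩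
      ⟨some .collect, Memory.init,
        contents [] [] w.reverse (tape w (fun _ => w.length - 1) ∅) [] []⟩ := by
  induction a generalizing t s with
  | nil =>
    simp only [List.length_nil, zero_mul, List.range_zero, List.map_nil, List.nil_append] at ht
    subst ht
    exact (Runs.step (by simp [program])).mono (by simp)
  | cons y a ih =>
    rcases s with ⟨sl, sc, so, sp, scarry, scur, sf⟩
    simp only [List.length_cons] at hs ha ht ⊢
    subst hs
    obtain ⟨p, f, h⟩ := runs_cells (rules := rules) (acc := acc) [] a w.reverse t
      ⟨some y, sc, so, Set.univ, {_i | a.length + 1 = w.length}, scur, sf⟩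
    simp only [row_eq w a.length ha, List.reverse_reverse, List.append_nil] at h
    have h' := runs_restore (rules := rules) (acc := acc) w a []
      (((List.range w.length).map fun b =>
        cellAt w (fun _ => w.length - 1) ∅ (a.length * w.length + b)) ++ t)
      ⟨none, sc, so, p, ∅, scur, f⟩
    simp only [List.append_nil] at h'
    have h'' := ih (((List.range w.length).map fun b =>
        cellAt w (fun _ => w.length - 1) ∅ (a.length * w.length + b)) ++ t)
        ⟨none, sc, so, p, ∅, scur, f⟩ (by
          ext i
          simp only [Set.mem_empty_iff_false, Set.mem_ofPred_eq, false_iff]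
          omega) (by omega) (by
          rw [← ht, add_mul, one_mul, List.range_add, List.map_append, List.map_map,
            List.append_assoc]
          rfl)
    refine (Runs.head (c' := ⟨some .cells, ⟨some y, sc, so, Set.univ, {_i | a.length + 1 = w.length}, scur, sf⟩,
      contents [] a w.reverse t [] []⟩) (by simp [program]) (h.trans (h'.trans h''))).mono ?_
    simp only [List.length_reverse]
    ring_nf
    rfl

theorem runs_build (w : List A) :
    Runs rules acc (w.length + 1 + (w.length * (2 * w.length + 3) + 1))
      ⟨some .load, Memory.init, contents w [] [] [] [] []⟩
      ⟨some .collect, Memory.init,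
        contents [] [] w.reverse (tape w (fun _ => w.length - 1) ∅) [] []⟩ := by
  have h1 := runs_load (rules := rules) (acc := acc) w [] [] Memory.init
  simp only [List.append_nil] at h1
  have h2 := runs_row (rules := rules) (acc := acc) w w.reverse []
    { Memory.init with ltr := none, carry := Set.univ } (by simp) (by simp) (by simp [tape])
  rw [List.length_reverse] at h2
  exact h1.trans h2

end Build

/-! ### Sweeps over the table -/

theorem foldl_collect (w : List A) (x : Fin M → ℕ) (D : Set (P × ℕ × ℕ)) (n : ℕ) :
    (((List.range n).map (cellAt w x D)).foldl Memory.collect Memory.init).prev =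
      {i | n ≠ 0 ∧ x i = (n - 1) % w.length} ∧
    (((List.range n).map (cellAt w x D)).foldl Memory.collect Memory.init).obs =
      {o | ∃ k < n, o ∈ (cellAt w x D k).obs {i | k ≠ 0 ∧ x i = (k - 1) % w.length}} := by
  induction n with
  | zero => simp [Memory.init]
  | succ n ih =>
    rw [List.range_succ, List.map_append, List.foldl_append]
    simp only [List.map_cons, List.map_nil, List.foldl_cons, List.foldl_nil, Memory.collect,
      ih.1, ih.2]
    refine ⟨by simp [cellAt], ?_⟩
    ext o
    simp only [Set.mem_union, Set.mem_ofPred_eq, Nat.lt_succ_iff_lt_or_eq, or_and_right, exists_or,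
      exists_eq_left]

/-- Every condition concerns at most two positions, so a single cell witnesses it, together with the
column marks of the preceding cell in the case of `succ`. The test on `fst` prevents the end of one
row from being taken as the predecessor of the start of the next. -/
theorem collect_obs (w : List A) (x : Fin M → ℕ) (hx : ∀ i, x i < w.length)
    (D : Set (P × ℕ × ℕ)) :
    ((tape w x D).foldl Memory.collect Memory.init).obs = {o | o.Holds w D x} := by
  rw [tape, (foldl_collect w x D _).2]
  have hcol : ∀ i, x i < w.length * w.length := fun i =>
    (hx i).trans_le (Nat.le_mul_of_pos_left _ ((Nat.zero_le _).trans_lt (hx i)))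
  ext o
  simp only [Set.mem_ofPred_eq]
  rcases o with ⟨a, i⟩ | i | ⟨i, j⟩ | ⟨p, i, j⟩
  · constructor
    · rintro ⟨k, -, h1, h2⟩
      simp only [cellAt, Set.mem_ofPred_eq] at h1 h2
      rw [← h1] at h2
      rw [Obs.Holds, List.getElem?_eq_getElem (hx i), ← h2, List.getD_eq_getElem _ _ (hx i)]
    · intro h
      refine ⟨x i, hcol i, ?_, ?_⟩
      · simp [cellAt, Nat.mod_eq_of_lt (hx i)]
      · rw [Obs.Holds] at h
        simp [cellAt, Nat.mod_eq_of_lt (hx i), h]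
  · constructor
    · rintro ⟨k, -, h1, h2⟩
      exact h1.trans h2
    · intro h
      have h : x i = 0 := h
      exact ⟨0, (Nat.zero_le _).trans_lt (hcol i), by simp [cellAt, h], by simp [cellAt]⟩
  · constructor
    · rintro ⟨k, -, h1, ⟨h0, h2⟩, h3⟩
      simp only [cellAt, Set.mem_ofPred_eq] at h1 h3
      obtain ⟨k, rfl⟩ := Nat.exists_eq_succ_of_ne_zero h0
      simp only [Nat.succ_eq_add_one, Nat.add_sub_cancel] at h1 h2 h3
      rw [Obs.Holds, h2, h3]
      rw [← Nat.mod_add_mod] at h1 ⊢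
      have h4 := Nat.mod_lt k ((Nat.zero_le _).trans_lt (hx i))
      rcases Nat.lt_or_ge (k % w.length + 1) w.length with h5 | h5
      · rw [Nat.mod_eq_of_lt h5]
      · exact absurd (by rw [show k % w.length + 1 = w.length by omega, Nat.mod_self]) h1
    · intro h
      have h : x i + 1 = x j := h
      have hi := hx i
      have hj := hx j
      refine ⟨x j, hcol j, ?_, ⟨by omega, ?_⟩, ?_⟩
      · simp only [cellAt, Nat.mod_eq_of_lt hj]; omega
      · rw [← h, Nat.add_sub_cancel, Nat.mod_eq_of_lt hi]
      · simp [cellAt, Nat.mod_eq_of_lt hj]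
  · constructor
    · rintro ⟨k, -, h1, h2, h3⟩
      simp only [cellAt, Set.mem_ofPred_eq] at h1 h2 h3
      rw [← h1, ← h2] at h3
      exact h3
    · intro h
      have hi := hx i
      have hj := hx j
      have e1 : (x i * w.length + x j) % w.length = x j := by
        rw [mul_comm, Nat.mul_add_mod, Nat.mod_eq_of_lt hj]
      have e2 : (x i * w.length + x j) / w.length = x i := by
        rw [mul_comm, Nat.mul_add_div (by omega), Nat.div_eq_of_lt hj, add_zero]
      refine ⟨x i * w.length + x j, by nlinarith, ?_, ?_, ?_⟩
      · simp [cellAt, e2]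
      · simp [cellAt, e1]
      · simpa [cellAt, e1, e2] using (show (p, x i, x j) ∈ D from h)

/-- The hypotheses on `s` are the invariant of the backward sweep: the memory describes cell `n`,
the one just after the cells still to be treated, with indices taken cyclically. `carry` holds the
marks of the row after that of cell `n`; it is unconstrained when cell `n` starts a row, because the
next cell treated then takes its following row from `cur`. -/
theorem sweep_eq {rules : Rules A P (Fin M)} {w : List A} {x : Fin M → ℕ}
    (hx : ∀ i, x i < w.length) {D : Set (P × ℕ × ℕ)} (hw : 0 < w.length) (n : ℕ)
    (hn : n ≤ w.length * w.length) (t : List (Cell A P M)) (s : Memory A P M)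
    (hobs : s.obs = {o | o.Holds w D x}) (hfst : s.fst ↔ n % w.length = 0)
    (hcur : s.cur = {i | x i = n / w.length % w.length})
    (hcarry : ¬ s.fst → s.carry = {i | x i = (n / w.length + 1) % w.length})
    (hprev : s.prev = {i | x i = n % w.length}) :
    (sweep rules s ((List.range n).map (cellAt w x D)).reverse t).1.obs = {o | o.Holds w D x} ∧
    (sweep rules s ((List.range n).map (cellAt w x D)).reverse t).2 =
      (List.range n).map (cellAt w (pred w.length x) (fire rules w x D)) ++ t := by
  induction n generalizing t s with
  | zero => exact ⟨hobs, rfl⟩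
  | succ n ih =>
    have hrow : n / w.length < w.length := Nat.div_lt_of_lt_mul (by omega)
    have hcol : n % w.length < w.length := Nat.mod_lt _ hw
    have hsucc : (n + 1) % w.length = (n % w.length + 1) % w.length := by simp
    have hz : s.zeros = {i | x i = 0} := by
      ext i; simp [Memory.zeros, hobs, Obs.Holds]
    have hc : {i | (s.fst ∧ i ∈ s.cur) ∨ (¬ s.fst ∧ i ∈ s.carry)} =
        {i | x i = (n / w.length + 1) % w.length} := by
      ext i
      by_cases h : s.fst
      · have h1 : w.length ∣ n + 1 := Nat.dvd_of_mod_eq_zero (hfst.1 h)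
        simp [h, hcur, Nat.succ_div, h1]
      · have h1 : ¬ w.length ∣ n + 1 := fun h1 => h (hfst.2 (Nat.mod_eq_zero_of_dvd h1))
        simp [h, hcarry h, Nat.succ_div, h1]
    have hcell : (s.update rules (cellAt w x D n)).cell =
        some (cellAt w (pred w.length x) (fire rules w x D) n) := by
      simp only [Memory.update, hc, hprev, hsucc, Option.some.injEq]
      simp only [cellAt, Cell.mk.injEq, true_and]
      refine ⟨decr_eq hx hrow hz, decr_eq hx hcol hz, ?_⟩
      simp only [hobs]
      ext p
      rfl
    rw [List.range_succ, List.map_append, List.map_cons, List.map_nil, List.reverse_append,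
      List.reverse_singleton, List.singleton_append, sweep, hcell, List.map_append,
      List.append_assoc]
    refine ih (by omega) _ _ hobs Iff.rfl ?_ (fun _ => hc) rfl
    rw [Nat.mod_eq_of_lt hrow]
    rfl

end Tables

end Saturation

/-! ### Correctness and running time of the machine -/

namespace Saturation

variable {A P : Type} {M : ℕ}

/-- Rules with variables in `V`, seen as rules with variables in a larger type. -/
def Rules.map {V V' : Type} (e : V → V') (rules : Rules A P V) : Rules A P V' := fun O p i j =>
  ∃ i' j', i = e i' ∧ j = e j' ∧ rules {o | (match o with
    | .letter a i => Obs.letter a (e i)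
    | .first i => Obs.first (e i)
    | .succ i j => Obs.succ (e i) (e j)
    | .fact p i j => Obs.fact p (e i) (e j) : Obs A P V') ∈ O} p i' j'

theorem Rules.map_holds {V V' : Type} (e : V → V') (rules : Rules A P V) (w : List A)
    (D : Set (P × ℕ × ℕ)) (x : V' → ℕ) (p : P) (i j : V') :
    rules.map e {o | o.Holds w D x} p i j ↔
      ∃ i' j', i = e i' ∧ j = e j' ∧ rules {o | o.Holds w D (x ∘ e)} p i' j' := by
  refine exists_congr fun i' => exists_congr fun j' => and_congr_right fun _ =>
    and_congr_right fun _ => ?_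
  have : {o : Obs A P V | (match o with
    | .letter a i => Obs.letter a (e i)
    | .first i => Obs.first (e i)
    | .succ i j => Obs.succ (e i) (e j)
    | .fact p i j => Obs.fact p (e i) (e j) : Obs A P V') ∈ {o | o.Holds w D x}} =
      {o | o.Holds w D (x ∘ e)} := by
    ext (_ | _ | _ | _) <;> rfl
  rw [this]

section Correctness

variable [Inhabited A]

/-! ### Correctness of the machine -/

section Loop

variable {rules : Rules A P (Fin M)} {acc : P}

/-- The step that ends the pass is left open as `c'`, because it branches on whether the assignment
was the last one. -/
theorem runs_pass {w : List A} (hw : 0 < w.length) {x : Fin M → ℕ} (hx : ∀ i, x i < w.length)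
    (D : Set (P × ℕ × ℕ)) :
    ∃ s : Memory A P M, s.obs = {o | o.Holds w D x} ∧ ∀ c',
      Turing.TM2.stepAux (program rules acc .update) s (contents [] [] w.reverse
        (tape w (pred w.length x) (fire rules w x D)) [] []) = c' →
      Runs rules acc (2 * (w.length * w.length) + 2)
        ⟨some .collect, Memory.init, contents [] [] w.reverse (tape w x D) [] []⟩ c' := by
  have h := runs_collect (rules := rules) (acc := acc) w.reverse (tape w x D) [] Memory.init
  have hobs := collect_obs w x hx D
  generalize (tape w x D).foldl Memory.collect Memory.init = s at h hobs
  have hz : s.zeros = {i | x i = 0} := by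
    ext i; simp [Memory.zeros, hobs, Obs.Holds]
  rw [hz, List.append_nil] at h
  have hs := sweep_eq (rules := rules) hx (D := D) hw _ le_rfl []
    { s with cell := none, fst := True, cur := {i | x i = 0}, prev := {i | x i = 0} }
    hobs (by simp) (by simp [Nat.mul_div_cancel _ hw]) (by simp) (by simp)
  rw [List.append_nil] at hs
  refine ⟨_, hs.1, fun c' hc' => (h.trans (runs_update (c' := c') w.reverse [] _ _ ?_)).mono ?_⟩
  · rw [tape, hs.2]; exact hc'
  · simp only [List.length_reverse, length_tape]; omega

theorem runs_next {w : List A} (hw : 0 < w.length) {t : ℕ} (ht : t + 1 < w.length ^ M)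
    (D : Set (P × ℕ × ℕ)) :
    Runs rules acc (2 * (w.length * w.length) + 2)
      ⟨some .collect, Memory.init,
        contents [] [] w.reverse (tape w (digit w.length M (t + 1)) D) [] []⟩
      ⟨some .collect, Memory.init, contents [] [] w.reverse
        (tape w (digit w.length M t) (fire rules w (digit w.length M (t + 1)) D)) [] []⟩ := by
  obtain ⟨s, hs, h⟩ := runs_pass (rules := rules) (acc := acc) hw (digit_lt hw M (t + 1)) D
  refine h _ ?_
  have hz : ¬ s.zeros = Set.univ := by
    intro h1
    have h2 := (digits_eq_zero ht).1 fun i => by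
      have h3 : i ∈ s.zeros := h1 ▸ Set.mem_univ i
      simpa [Memory.zeros, hs, Obs.Holds] using h3
    omega
  have hz' : ¬ ({ s with cell := none } : Memory A P M).zeros = Set.univ := hz
  simp [program, hz', digit_pred hw]

theorem runs_last {w : List A} (hw : 0 < w.length) (D : Set (P × ℕ × ℕ)) :
    ∃ s : Memory A P M, s.obs = {o | o.Holds w D (digit w.length M 0)} ∧
    Runs rules acc (2 * (w.length * w.length) + 2)
      ⟨some .collect, Memory.init,
        contents [] [] w.reverse (tape w (digit w.length M 0) D) [] []⟩
      ⟨some .clean, s, contents [] [] w.reverse (tape w (pred w.length (digit w.length M 0))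
        (fire rules w (digit w.length M 0) D)) [] []⟩ := by
  obtain ⟨s, hs, h⟩ := runs_pass (rules := rules) (acc := acc) hw (digit_lt hw M 0) D
  refine ⟨{ s with cell := none }, hs, h _ ?_⟩
  have hz : ({ s with cell := none } : Memory A P M).zeros = Set.univ := by
    ext i
    simp [Memory.zeros, hs, Obs.Holds, digit]
  simp [program, hz]

theorem runs_loop {w : List A} (hw : 0 < w.length) (t₀ t n : ℕ) (ht : t + n = t₀)
    (ht₀ : t₀ < w.length ^ M) :
    Runs rules acc (t * (2 * (w.length * w.length) + 2))
      ⟨some .collect, Memory.init, contents [] [] w.reverse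
        (tape w (digit w.length M t) (facts rules w t₀ n)) [] []⟩
      ⟨some .collect, Memory.init, contents [] [] w.reverse
        (tape w (digit w.length M 0) (facts rules w t₀ t₀)) [] []⟩ := by
  induction t generalizing n with
  | zero =>
    rw [zero_add] at ht
    subst ht
    exact (Runs.refl _).mono (by simp)
  | succ t ih =>
    have h1 := runs_next (rules := rules) (acc := acc) hw (t := t) (by omega)
      (facts rules w t₀ n)
    have h2 := ih (n + 1) (by omega)
    rw [facts, show t₀ - n = t + 1 by omega] at h2
    exact (h1.trans h2).mono (by rw [add_mul]; omega)

end Loop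

/-- A bound on the number of steps of the machine. -/
noncomputable def timeBound (M : ℕ) : Polynomial ℕ :=
  let X : Polynomial ℕ := Polynomial.X
  (X + 1 + (X * (2 * X + 3) + 1)) + X ^ M * (2 * (X * X) + 2) + (2 * (X * X) + 2) +
    (X + X * X + 1)

open scoped Classical in
theorem runs_machine {rules : Rules A P (Fin M)} {acc : P} {w : List A} (hw : 0 < w.length)
    (hM : 0 < M) :
    Runs rules acc ((timeBound M).eval w.length)
      ⟨some .load, Memory.init, contents w [] [] [] [] []⟩
      ⟨none, Memory.init, contents [] [] [] [] []
        [decide ((acc, 0, 0) ∈ facts rules w (w.length ^ M - 1) (w.length ^ M - 1))]⟩ := by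
  have hp : 0 < w.length ^ M := by positivity
  have h1 := runs_build (rules := rules) (acc := acc) w
  have h2 := runs_loop (rules := rules) (acc := acc) hw (w.length ^ M - 1) (w.length ^ M - 1) 0
    (by omega) (by omega)
  have h0 : digit w.length M (w.length ^ M - 1) = fun _ => w.length - 1 :=
    funext fun i => digit_top hw i
  rw [h0] at h2
  obtain ⟨s, hs, h3⟩ := runs_last (rules := rules) (acc := acc) hw
    (facts rules w (w.length ^ M - 1) (w.length ^ M - 1))
  have h4 := runs_clean (rules := rules) (acc := acc) w.reverse (tape w
    (pred w.length (digit w.length M 0)) (fire rules w (digit w.length M 0)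
    (facts rules w (w.length ^ M - 1) (w.length ^ M - 1)))) s
  -- In the last pass observations precede the firing of rules, so the answer is read from the facts
  -- found before assignment `0` is treated. A variable must exist for the observation to be made,
  -- hence `0 < M`.
  have ho : (∃ i, Obs.fact acc i i ∈ s.obs) ↔
      (acc, 0, 0) ∈ facts rules w (w.length ^ M - 1) (w.length ^ M - 1) := by
    simp only [hs, Set.mem_ofPred_eq, Obs.Holds, digit, Nat.zero_div, Nat.zero_mod]
    exact ⟨fun ⟨_, h⟩ => h, fun h => ⟨⟨0, hM⟩, h⟩⟩
  simp only [ho] at h4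
  refine (h1.trans (h2.trans (h3.trans h4))).mono ?_
  have hle : (w.length ^ M - 1) * (2 * (w.length * w.length) + 2) ≤
      w.length ^ M * (2 * (w.length * w.length) + 2) := Nat.mul_le_mul_right _ (Nat.sub_le _ _)
  simp only [timeBound, Polynomial.eval_add, Polynomial.eval_mul, Polynomial.eval_X,
    Polynomial.eval_one, Polynomial.eval_pow, Polynomial.eval_ofNat, List.length_reverse,
    length_tape]
  omega

theorem initList_machine [Finite A] [Finite P] (rules : Rules A P (Fin M)) (acc : P)
    (w : List A) : Turing.initList (machine rules acc) w =
      ⟨some .load, Memory.init, contents w [] [] [] [] []⟩ := by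
  unfold Turing.initList
  congr 1
  funext s
  cases s <;> rfl

theorem haltList_machine [Finite A] [Finite P] (rules : Rules A P (Fin M)) (acc : P)
    (b : List Bool) : Turing.haltList (machine rules acc) b =
      ⟨none, Memory.init, contents [] [] [] [] [] b⟩ := by
  unfold Turing.haltList
  congr 1
  funext s
  cases s <;> rfl

open scoped Classical in
/-- Whether the fact `acc(0, 0)` follows by a finite system of monotone rules from the letters of
a word can be decided in polynomial time. -/
theorem decidableInPTime [Finite A] [Finite P] {V : Type} [Finite V] (rules : Rules A P V)
    (mono : ∀ O O' : Set (Obs A P V), O ⊆ O' → ∀ p i j, rules O p i j → rules O' p i j)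
    (acc : P) {α : Type} (enc : α → List A) (L : Set α) (hlen : ∀ a, 2 ≤ (enc a).length)
    (hL : ∀ a, a ∈ L ↔ ∀ D, Closed rules (enc a) D → (acc, 0, 0) ∈ D) :
    SPLogic.DecidableInPTime enc L := by
  obtain ⟨m, ⟨e⟩⟩ := Finite.exists_equiv_fin V
  -- The variables of the rules occupy the `m` low digits; the remaining ones form the clock
  -- required by `acc_mem_facts`.
  set M := m + (Nat.card P + 3) with hM
  set e' : V → Fin M := fun v => Fin.castLE (by omega) (e v) with he'
  have he'inj : Function.Injective e' := (Fin.castLE_injective _).comp e.injective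
  have he'lt : ∀ v, (e' v : ℕ) < m := fun v => (e v).2
  have hclosed : ∀ (w : List A) (hw : 0 < w.length) D,
      Closed (rules.map e') w D ↔ Closed rules w D := by
    intro w hw D
    constructor
    · intro h x hx p i j hr
      have hx' : (fun k => Function.extend e' x (fun _ => 0) k) ∘ e' = x :=
        funext fun v => (he'inj.extend_apply x (fun _ => 0) v : _)
      have h1 := h (Function.extend e' x fun _ => 0) (fun k => by
        by_cases hk : ∃ v, e' v = k
        · obtain ⟨v, rfl⟩ := hk
          rw [he'inj.extend_apply]; exact hx v
        · rw [Function.extend_apply' _ _ _ hk]; exact hw) p (e' i) (e' j)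
        ((Rules.map_holds _ _ _ _ _ _ _ _).2 ⟨i, j, rfl, rfl, by rw [hx']; exact hr⟩)
      rwa [he'inj.extend_apply, he'inj.extend_apply] at h1
    · intro h x hx p i j hr
      obtain ⟨i', j', rfl, rfl, hr'⟩ := (Rules.map_holds _ _ _ _ _ _ _ _).1 hr
      exact h (x ∘ e') (fun v => hx _) p i' j' hr'
  have hacc : ∀ a, ((acc, 0, 0) ∈ facts (rules.map e') (enc a) ((enc a).length ^ M - 1)
      ((enc a).length ^ M - 1)) ↔ a ∈ L := by
    intro a
    have hw : 0 < (enc a).length := (by omega : 0 < 2).trans_le (hlen a)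
    rw [hL, acc_mem_facts (m := m) _ _ ?_ hM (hlen a) ?_]
    · exact forall_congr' fun D => by rw [hclosed _ hw]
    · rintro O O' hO p _ _ ⟨i, j, rfl, rfl, h⟩
      exact ⟨i, j, rfl, rfl, mono _ _ (fun o ho => hO ho) _ _ _ h⟩
    · intro D x y hxy p i j h
      obtain ⟨i', j', rfl, rfl, h'⟩ := (Rules.map_holds _ _ _ _ _ _ _ _).1 h
      refine ⟨he'lt _, he'lt _, (Rules.map_holds _ _ _ _ _ _ _ _).2 ⟨i', j', rfl, rfl, ?_⟩⟩
      rwa [show y ∘ e' = x ∘ e' from funext fun v => (hxy _ (he'lt v)).symm]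
  have hrun := fun a => runs_machine (rules := rules.map e') (acc := acc) (w := enc a)
    ((by omega : 0 < 2).trans_le (hlen a)) (by omega : 0 < M)
  choose k hk hrun using hrun
  refine ⟨{
    tm := machine (rules.map e') acc
    inputAlphabet := Equiv.refl A
    outputAlphabet := Equiv.refl Bool
    time := timeBound M
    outputsFun := fun a => ⟨⟨k a, ?_⟩, hk a⟩ }⟩
  have h := hrun a
  simp only [hacc] at h
  have hi := (congrArg (Turing.initList (machine (rules.map e') acc))
    (List.map_id (enc a))).trans (initList_machine (rules.map e') acc (enc a))
  have ho := haltList_machine (rules.map e') acc [decide (a ∈ L)]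
  exact (congrArg (fun c => (flip bind (Turing.TM2.step (program (rules.map e') acc)))^[k a]
    (some c)) hi).trans (h.trans (congrArg some ho).symm)

end Correctness

end Saturation

/-! ### Free models, the finite frame property and the Lindenbaum algebra -/

namespace SPLogic

variable {R : Type}

/-! ### Homomorphisms and tree models -/

theorem Frame.Sat.map {F F' : Frame R} {v : ℕ → Set F.W} {v' : ℕ → Set F'.W} (f : F.W → F'.W)
    (hrel : ∀ r x y, F.rel r x y → F'.rel r (f x) (f y)) (hval : ∀ p, ∀ x ∈ v p, f x ∈ v' p)
    {φ : Formula R} {w : F.W} (h : F.Sat v w φ) : F'.Sat v' (f w) φ := by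
  induction φ generalizing w with
  | top => trivial
  | var p => exact hval p w h
  | and σ τ ihσ ihτ => exact ⟨ihσ h.1, ihτ h.2⟩
  | dia r σ ih =>
    obtain ⟨w', hw, h⟩ := h
    exact ⟨f w', hrel _ _ _ hw, ih h⟩

theorem Formula.tree_sat (σ : Formula R) : σ.tree.Sat σ.treeVal none σ := by
  induction σ with
  | top => trivial
  | var p => exact rfl
  | and σ τ ihσ ihτ =>
    exact ⟨ihσ.map (F' := (Formula.and σ τ).tree) (Option.map Sum.inl)
        (fun r x y h => Or.inl ⟨x, y, rfl, rfl, h⟩) (fun p x h => Or.inl ⟨x, h, rfl⟩),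
      ihτ.map (F' := (Formula.and σ τ).tree) (Option.map Sum.inr)
        (fun r x y h => Or.inr ⟨x, y, rfl, rfl, h⟩) (fun p x h => Or.inr ⟨x, h, rfl⟩)⟩
  | dia r σ ih =>
    exact ⟨some none, Or.inl ⟨rfl, rfl, rfl⟩,
      ih.map (F' := (Formula.dia r σ).tree) (v' := (Formula.dia r σ).treeVal) some
        (fun r x y h => Or.inr ⟨x, y, rfl, rfl, h⟩) (fun p x h => ⟨x, h, rfl⟩)⟩

/-- The witnesses chosen for the diamonds are the images of the points of the tree. In a conjunction
the two maps agree at the shared root and can be glued. -/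
theorem Formula.exists_hom {σ : Formula R} {F : Frame R} {v : ℕ → Set F.W} {w : F.W}
    (h : F.Sat v w σ) : ∃ f : σ.Point → F.W, f none = w ∧
      (∀ r x y, σ.treeRel r x y → F.rel r (f x) (f y)) ∧ ∀ p, ∀ x ∈ σ.treeVal p, f x ∈ v p := by
  induction σ generalizing w with
  | top => exact ⟨fun _ => w, rfl, fun _ _ _ h => h.elim, fun _ _ h => h.elim⟩
  | var p =>
    refine ⟨fun _ => w, rfl, fun _ _ _ h => h.elim, fun q x hx => ?_⟩
    have hq : q = p := hx
    subst hq
    exact h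
  | and σ τ ihσ ihτ =>
    obtain ⟨f, hf, hfr, hfv⟩ := ihσ h.1
    obtain ⟨g, hg, hgr, hgv⟩ := ihτ h.2
    let k : (Formula.and σ τ).Point → F.W := fun x => match x with
      | none => w
      | some (.inl a) => f (some a)
      | some (.inr a) => g (some a)
    have h1 : ∀ a : σ.Point, k (Option.map Sum.inl a) = f a := by
      rintro (_ | a)
      · exact hf.symm
      · rfl
    have h2 : ∀ a : τ.Point, k (Option.map Sum.inr a) = g a := by
      rintro (_ | a)
      · exact hg.symm
      · rfl
    refine ⟨k, rfl, ?_, ?_⟩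
    · rintro r _ _ (⟨a, b, rfl, rfl, hab⟩ | ⟨a, b, rfl, rfl, hab⟩)
      · exact (congrArg₂ (F.rel r) (h1 a) (h1 b)).mpr (hfr _ _ _ hab)
      · exact (congrArg₂ (F.rel r) (h2 a) (h2 b)).mpr (hgr _ _ _ hab)
    · rintro p _ (⟨a, ha, rfl⟩ | ⟨a, ha, rfl⟩)
      · exact (congrArg (· ∈ v p) (h1 a)).mpr (hfv _ _ ha)
      · exact (congrArg (· ∈ v p) (h2 a)).mpr (hgv _ _ ha)
  | dia r σ ih =>
    obtain ⟨w', hw, h⟩ := h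
    obtain ⟨f, hf, hfr, hfv⟩ := ih h
    refine ⟨fun x => x.elim w f, rfl, ?_, ?_⟩
    · rintro s _ _ (⟨rfl, rfl, rfl⟩ | ⟨a, b, rfl, rfl, hab⟩)
      · exact (congrArg (F.rel s w) hf).mpr hw
      · exact hfr _ _ _ hab
    · rintro p _ ⟨a, ha, rfl⟩
      exact hfv _ _ ha

/-! ### Closures of tree models -/

section Closure

variable {Ax : Set (Implication R)} {π : Implication R → Profile R}

theorem closure_isFrameFor (hπ : ∀ ι ∈ Ax, (π ι).IsProfileOf ι) (F : Frame R) :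
    (F.closure (π '' Ax)).IsFrameFor Ax := fun κ hκ =>
  (hπ κ hκ _).2 ((Frame.closure_spec (π '' Ax) F).2 _ ⟨κ, hκ, rfl⟩)

theorem closure_tree_sat (P : Set (Profile R)) (σ : Formula R) :
    (σ.tree.closure P).Sat σ.treeVal none σ :=
  Frame.Sat.map (F := σ.tree) (F' := σ.tree.closure P) id (Frame.closure_spec P σ.tree).1
    (fun _ _ h => h) σ.tree_sat

theorem krConsequence_iff (hπ : ∀ ι ∈ Ax, (π ι).IsProfileOf ι) (σ τ : Formula R) :
    KrConsequence Ax ⟨σ, τ⟩ ↔ (σ.tree.closure (π '' Ax)).Sat σ.treeVal none τ := by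
  refine ⟨fun h => h _ (closure_isFrameFor hπ _) _ _ (closure_tree_sat _ σ), fun h F hF v w hw => ?_⟩
  obtain ⟨f, rfl, hfr, hfv⟩ := Formula.exists_hom hw
  refine h.map (F' := F) f (fun r x y hxy => ?_) hfv
  -- The closure lies below every relation that contains the tree and satisfies the profiles. The
  -- relation pulled back from `F` along `f` is one: a homomorphism into it, composed with `f`, is a
  -- homomorphism into `F`.
  refine hxy (fun r x y => F.rel r (f x) (f y)) hfr ?_
  rintro _ ⟨κ, hκ, rfl⟩ g hg
  exact (hπ κ hκ F).1 (hF κ hκ) (f ∘ g) hg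

end Closure

/-! ### Soundness of the calculus for frames -/

theorem Formula.subst_var (φ : Formula R) : φ.subst .var = φ := by
  induction φ <;> simp_all [Formula.subst]

theorem Frame.sat_subst (F : Frame R) (v : ℕ → Set F.W) (s : ℕ → Formula R) (φ : Formula R)
    (w : F.W) :
    F.Sat v w (φ.subst s) ↔ F.Sat (fun p => {x | F.Sat v x (s p)}) w φ := by
  induction φ generalizing w with
  | top => exact Iff.rfl
  | var p => exact Iff.rfl
  | and σ τ ihσ ihτ => exact and_congr (ihσ w) (ihτ w)
  | dia r σ ih => exact exists_congr fun w' => and_congr_right fun _ => ih w'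

theorem Derivable.sat {Ax : Set (Implication R)} {F : Frame R} (hF : F.IsFrameFor Ax)
    {σ τ : Formula R} (h : Derivable Ax σ τ) (v : ℕ → Set F.W) (w : F.W) :
    F.Sat v w σ → F.Sat v w τ := by
  induction h generalizing w with
  | ax ι s hι =>
    rw [F.sat_subst, F.sat_subst]
    exact hF ι hι _ w
  | refl σ => exact id
  | top σ => exact fun _ => trivial
  | and_comm σ τ => exact fun h => ⟨h.2, h.1⟩
  | and_left σ τ => exact fun h => h.1
  | trans _ _ ih₁ ih₂ => exact fun h => ih₂ w (ih₁ w h)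
  | and_intro _ _ ih₁ ih₂ => exact fun h => ⟨ih₁ w h, ih₂ w h⟩
  | dia r _ ih => exact fun ⟨w', hw, h⟩ => ⟨w', hw, ih w' h⟩

theorem subset_SPi (Ax : Set (Implication R)) : Ax ⊆ SPi Ax := fun ι hι => by
  have h := Derivable.ax ι .var hι
  rwa [Formula.subst_var, Formula.subst_var] at h

theorem isFrameFor_SPi_iff {Ax : Set (Implication R)} {F : Frame R} :
    F.IsFrameFor (SPi Ax) ↔ F.IsFrameFor Ax :=
  ⟨fun h κ hκ => h κ (subset_SPi Ax hκ), fun h _ hκ v w => hκ.sat h v w⟩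

/-! ### The polynomial finite frame property -/

/-- The relation symbols of a formula. -/
def Formula.symbols : Formula R → Set R
  | .top => ∅
  | .var _ => ∅
  | .and σ τ => σ.symbols ∪ τ.symbols
  | .dia r σ => insert r σ.symbols

theorem Formula.finite_symbols (σ : Formula R) : σ.symbols.Finite := by
  induction σ with
  | top => exact Set.finite_empty
  | var p => exact Set.finite_empty
  | and σ τ ihσ ihτ => exact ihσ.union ihτ
  | dia r σ ih => exact ih.insert r

theorem Formula.ncard_symbols_le (σ : Formula R) : σ.symbols.ncard ≤ σ.size := by
  induction σ with
  | top => simp [Formula.symbols]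
  | var p => simp [Formula.symbols]
  | and σ τ ihσ ihτ =>
    have := Set.ncard_union_le σ.symbols τ.symbols
    simp only [Formula.symbols, Formula.size]
    omega
  | dia r σ ih =>
    have := Set.ncard_insert_le r σ.symbols
    simp only [Formula.symbols, Formula.size]
    omega

theorem Formula.finite_nonRoot (σ : Formula R) : Finite σ.NonRoot := by
  induction σ with
  | top => exact inferInstanceAs (Finite Empty)
  | var p => exact inferInstanceAs (Finite Empty)
  | and σ τ ihσ ihτ => exact inferInstanceAs (Finite (σ.NonRoot ⊕ τ.NonRoot))
  | dia r σ ih => exact inferInstanceAs (Finite (Option σ.NonRoot))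

theorem Formula.card_nonRoot_lt (σ : Formula R) : Nat.card σ.NonRoot < σ.size := by
  induction σ with
  | top => exact (Nat.card_of_isEmpty (α := Empty)).trans_lt Nat.one_pos
  | var p => exact (Nat.card_of_isEmpty (α := Empty)).trans_lt Nat.one_pos
  | and σ τ ihσ ihτ =>
    have := σ.finite_nonRoot
    have := τ.finite_nonRoot
    have h : Nat.card (Formula.and σ τ).NonRoot = Nat.card σ.NonRoot + Nat.card τ.NonRoot :=
      Nat.card_sum
    simp only [Formula.size]
    omega
  | dia r σ ih =>
    have := σ.finite_nonRoot
    have h : Nat.card (Formula.dia r σ).NonRoot = Nat.card σ.NonRoot + 1 := Finite.card_option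
    simp only [Formula.size]
    omega

theorem Formula.mem_symbols_of_treeRel {σ : Formula R} {r : R} {x y : σ.Point}
    (h : σ.treeRel r x y) : r ∈ σ.symbols := by
  induction σ with
  | top => exact h.elim
  | var p => exact h.elim
  | and σ τ ihσ ihτ =>
    rcases h with ⟨a, b, rfl, rfl, h⟩ | ⟨a, b, rfl, rfl, h⟩
    · exact Or.inl (ihσ h)
    · exact Or.inr (ihτ h)
  | dia s σ ih =>
    rcases h with ⟨rfl, -, -⟩ | ⟨a, b, rfl, rfl, h⟩
    · exact Set.mem_insert _ _
    · exact Set.mem_insert_of_mem _ (ih h)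

/-- The relations that are full for these symbols and empty for all others contain the tree and
satisfy every profile. This bounds the number of labelled arrows even when the signature is
infinite. -/
theorem mem_symbols_of_closure_rel {P : Set (Profile R)} {σ : Formula R} {r : R} {x y : σ.Point}
    (h : (σ.tree.closure P).rel r x y) : r ∈ σ.symbols ∪ Profile.S '' P :=
  h (fun r _ _ => r ∈ σ.symbols ∪ Profile.S '' P)
    (fun _ _ _ h => Or.inl (Formula.mem_symbols_of_treeRel h))
    (fun π hπ _ _ => Or.inr ⟨π, hπ, rfl⟩)

theorem size_closure_tree_le {P : Set (Profile R)} (hP : P.Finite) (σ : Formula R) :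
    (σ.tree.closure P).size ≤ (σ.size + (σ.size + P.ncard) * (σ.size * σ.size) : ℕ) := by
  have := σ.finite_nonRoot
  have hpt : Nat.card σ.Point ≤ σ.size := by
    rw [Finite.card_option]; exact σ.card_nonRoot_lt
  have hfin : (σ.symbols ∪ Profile.S '' P).Finite := σ.finite_symbols.union (hP.image _)
  have := hfin.to_subtype
  let f : {e : R × σ.Point × σ.Point // (σ.tree.closure P).rel e.1 e.2.1 e.2.2} →
      ↥(σ.symbols ∪ Profile.S '' P) × σ.Point × σ.Point :=
    fun e => (⟨e.1.1, mem_symbols_of_closure_rel e.2⟩, e.1.2)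
  have hf : Function.Injective f := by
    rintro ⟨⟨r, x⟩, h⟩ ⟨⟨r', x'⟩, h'⟩ heq
    simp only [f, Prod.mk.injEq, Subtype.mk.injEq] at heq
    exact Subtype.ext (Prod.ext heq.1 heq.2)
  have := Finite.of_injective f hf
  have harr := Nat.card_le_card_of_injective f hf
  rw [Nat.card_prod, Nat.card_prod, Nat.card_coe_set_eq] at harr
  have hsym : (σ.symbols ∪ Profile.S '' P).ncard ≤ σ.size + P.ncard :=
    (Set.ncard_union_le _ _).trans
      (Nat.add_le_add σ.ncard_symbols_le (Set.ncard_image_le hP))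
  have hmain : Nat.card σ.Point +
      Nat.card {e : R × σ.Point × σ.Point // (σ.tree.closure P).rel e.1 e.2.1 e.2.2} ≤
        σ.size + (σ.size + P.ncard) * (σ.size * σ.size) :=
    Nat.add_le_add hpt (harr.trans (Nat.mul_le_mul hsym (Nat.mul_le_mul hpt hpt)))
  have hsize : (σ.tree.closure P).size = ((Nat.card σ.Point + Nat.card
      {e : R × σ.Point × σ.Point // (σ.tree.closure P).rel e.1 e.2.1 e.2.2} : ℕ) : ℕ∞) := by
    rw [Nat.cast_add, ← ENat.card_eq_coe_natCard, ← ENat.card_eq_coe_natCard]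
    rfl
  rw [hsize]
  exact_mod_cast hmain

theorem hasPolyFiniteFrameProperty {Ax : Set (Implication R)} (hfin : Ax.Finite)
    {π : Implication R → Profile R} (hπ : ∀ ι ∈ Ax, (π ι).IsProfileOf ι) :
    HasPolyFiniteFrameProperty (SPi Ax) := by
  refine ⟨Polynomial.X + (Polynomial.X + Polynomial.C (π '' Ax).ncard) *
    (Polynomial.X * Polynomial.X), ?_⟩
  rintro ⟨σ, τ⟩ ⟨F, hF, hι⟩
  rw [isFrameFor_SPi_iff] at hF
  refine ⟨σ.tree.closure (π '' Ax), isFrameFor_SPi_iff.2 (closure_isFrameFor hπ _),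
    fun h => hι ?_, (size_closure_tree_le (hfin.image π) σ).trans ?_⟩
  · exact (krConsequence_iff hπ σ τ).2 (h _ _ (closure_tree_sat _ σ)) F hF
  · have hle : σ.size ≤ (⟨σ, τ⟩ : Implication R).size := Nat.le_add_right _ _
    simp only [Polynomial.eval_add, Polynomial.eval_mul, Polynomial.eval_X, Polynomial.eval_C]
    exact_mod_cast by gcongr

/-! ### Algebraic completeness of the calculus -/

theorem SLO.eval_subst (𝔄 : SLO R) (a : ℕ → 𝔄.A) (s : ℕ → Formula R) (φ : Formula R) :
    𝔄.eval a (φ.subst s) = 𝔄.eval (fun p => 𝔄.eval a (s p)) φ := by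
  induction φ <;> simp_all [Formula.subst, SLO.eval]

theorem Derivable.le {Ax : Set (Implication R)} {𝔄 : SLO R} (hA : ∀ κ ∈ Ax, 𝔄.Validates κ)
    {σ τ : Formula R} (h : Derivable Ax σ τ) (a : ℕ → 𝔄.A) :
    𝔄.meet (𝔄.eval a σ) (𝔄.eval a τ) = 𝔄.eval a σ := by
  induction h with
  | ax ι s hι =>
    rw [SLO.eval_subst, SLO.eval_subst]
    exact hA ι hι _
  | refl σ => exact 𝔄.meet_idem _
  | top σ => exact 𝔄.meet_top _
  | and_comm σ τ =>
    simp only [SLO.eval]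
    rw [𝔄.meet_comm (𝔄.eval a τ), 𝔄.meet_idem]
  | and_left σ τ =>
    simp only [SLO.eval]
    rw [𝔄.meet_comm, 𝔄.meet_assoc, 𝔄.meet_idem]
  | trans _ _ ih₁ ih₂ => rw [← ih₁, ← 𝔄.meet_assoc, ih₂]
  | and_intro _ _ ih₁ ih₂ =>
    simp only [SLO.eval]
    rw [𝔄.meet_assoc, ih₁, ih₂]
  | dia r _ ih =>
    simp only [SLO.eval]
    rw [← ih, 𝔄.dia_mono]

section Lindenbaum

variable (Ax : Set (Implication R))

theorem Derivable.and_right {Ax : Set (Implication R)} (σ τ : Formula R) :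
    Derivable Ax (.and σ τ) τ := (Derivable.and_comm σ τ).trans (.and_left τ σ)

theorem Derivable.and_mono {Ax : Set (Implication R)} {σ τ σ' τ' : Formula R}
    (h : Derivable Ax σ σ') (h' : Derivable Ax τ τ') :
    Derivable Ax (.and σ τ) (.and σ' τ') :=
  ((Derivable.and_left σ τ).trans h).and_intro ((Derivable.and_right σ τ).trans h')

/-- Mutual derivability. -/
def derivSetoid : Setoid (Formula R) where
  r σ τ := Derivable Ax σ τ ∧ Derivable Ax τ σ
  iseqv := ⟨fun σ => ⟨.refl σ, .refl σ⟩, fun h => ⟨h.2, h.1⟩,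
    fun h h' => ⟨h.1.trans h'.1, h'.2.trans h.2⟩⟩

/-- The Lindenbaum algebra. -/
def lindenbaum : SLO R where
  A := Quotient (derivSetoid Ax)
  meet := Quotient.map₂ .and fun _ _ h _ _ h' => ⟨h.1.and_mono h'.1, h.2.and_mono h'.2⟩
  top := Quotient.mk _ .top
  dia r := Quotient.map (.dia r) fun _ _ h => ⟨h.1.dia r, h.2.dia r⟩
  meet_idem := by
    rintro ⟨σ⟩
    exact Quotient.sound ⟨.and_left σ σ, (Derivable.refl σ).and_intro (.refl σ)⟩
  meet_comm := by
    rintro ⟨σ⟩ ⟨τ⟩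
    exact Quotient.sound ⟨.and_comm σ τ, .and_comm τ σ⟩
  meet_assoc := by
    rintro ⟨σ⟩ ⟨τ⟩ ⟨ρ⟩
    exact Quotient.sound
      ⟨((Derivable.and_left _ _).and_intro ((Derivable.and_right _ _).trans
          (.and_left _ _))).and_intro ((Derivable.and_right _ _).trans (.and_right _ _)),
        ((Derivable.and_left _ _).trans (.and_left _ _)).and_intro
          (((Derivable.and_left _ _).trans (.and_right _ _)).and_intro (.and_right _ _))⟩
  meet_top := by
    rintro ⟨σ⟩
    exact Quotient.sound ⟨.and_left _ _, (Derivable.refl σ).and_intro (.top σ)⟩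
  dia_mono := by
    rintro r ⟨σ⟩ ⟨τ⟩
    exact Quotient.sound ⟨.and_left _ _,
      (Derivable.refl _).and_intro ((Derivable.and_right σ τ).dia r)⟩

theorem lindenbaum_eval (s : ℕ → Formula R) (φ : Formula R) :
    (lindenbaum Ax).eval (fun p => (Quotient.mk (derivSetoid Ax) (s p))) φ =
      Quotient.mk (derivSetoid Ax) (φ.subst s) := by
  induction φ with
  | top => rfl
  | var p => rfl
  | and σ τ ihσ ihτ => simp only [SLO.eval, ihσ, ihτ]; rfl
  | dia r σ ih => simp only [SLO.eval, ih]; rfl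

theorem lindenbaum_le {σ τ : Formula R} :
    (lindenbaum Ax).le (Quotient.mk (derivSetoid Ax) σ) (Quotient.mk (derivSetoid Ax) τ) ↔
      Derivable Ax σ τ := by
  constructor
  · intro h
    have h' : Quotient.mk (derivSetoid Ax) (.and σ τ) = Quotient.mk (derivSetoid Ax) σ := h
    exact (Quotient.exact h').2.trans (.and_right σ τ)
  · intro h
    exact Quotient.sound (s := derivSetoid Ax)
      ⟨.and_left σ τ, (Derivable.refl σ).and_intro h⟩

/-- A valuation in the Lindenbaum algebra is a substitution up to mutual derivability, so the
algebra validates the axioms because their substitution instances are derivable. The valuation by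
the variables' own classes refutes whatever is not derivable. -/
theorem mem_SPi_iff (ι : Implication R) : ι ∈ SPi Ax ↔ SLOConsequence Ax ι := by
  refine ⟨fun h 𝔄 hA a => Derivable.le hA h a, fun h => ?_⟩
  have h1 := h (lindenbaum Ax) (fun κ hκ a => ?_) fun p => Quotient.mk (derivSetoid Ax) (.var p)
  · rw [lindenbaum_eval, lindenbaum_eval, lindenbaum_le, Formula.subst_var,
      Formula.subst_var] at h1
    exact h1
  · obtain ⟨s, rfl⟩ : ∃ s : ℕ → Formula R, (fun p => Quotient.mk (derivSetoid Ax) (s p)) = a :=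
      ⟨fun p => (a p).out, funext fun p => Quotient.out_eq _⟩
    rw [lindenbaum_eval, lindenbaum_eval, lindenbaum_le]
    exact .ax κ s hκ

end Lindenbaum

end SPLogic

/-! ### Rules for Kripke consequence on encoded implications, and their soundness -/

namespace SPLogic

variable {R : Type}

/-! ### Formulas and names inside a word -/

section Words

variable {α : Type} {w l l' : List α} {a : α} {i : ℕ}

theorem cons_prefix_drop : a :: l <+: w.drop i ↔ w[i]? = some a ∧ l <+: w.drop (i + 1) := by
  rcases Nat.lt_or_ge i w.length with h | h
  · rw [List.drop_eq_getElem_cons h, List.cons_prefix_cons, List.getElem?_eq_getElem h,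
      Option.some_inj, eq_comm]
  · rw [List.drop_of_length_le h, List.getElem?_eq_none h]
    simp

theorem append_prefix_drop :
    l ++ l' <+: w.drop i ↔ l <+: w.drop i ∧ l' <+: w.drop (i + l.length) := by
  induction l generalizing i with
  | nil => simp
  | cons a l ih =>
    rw [List.cons_append, cons_prefix_drop, cons_prefix_drop, ih, List.length_cons, and_assoc,
      add_assoc, add_comm 1]

end Words

/-- The word `w` has the name `l` at position `i`. -/
def NameAt (w : List Letter) (i : ℕ) (l : List Bool) : Prop :=
  l.map .bit ++ [.sep] <+: w.drop i

theorem nameAt_nil {w : List Letter} {i : ℕ} : NameAt w i [] ↔ w[i]? = some .sep := by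
  rw [NameAt, List.map_nil, List.nil_append, cons_prefix_drop]
  simp

theorem nameAt_cons {w : List Letter} {i : ℕ} {b : Bool} {l : List Bool} :
    NameAt w i (b :: l) ↔ w[i]? = some (.bit b) ∧ NameAt w (i + 1) l := by
  rw [NameAt, List.map_cons, List.cons_append, cons_prefix_drop]
  rfl

/-- The closing `sep` makes the set of encoded names prefix-free. -/
theorem NameAt.unique {w : List Letter} {i : ℕ} {l l' : List Bool} (h : NameAt w i l)
    (h' : NameAt w i l') : l = l' := by
  induction l generalizing i l' with
  | nil =>
    rw [nameAt_nil] at h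
    rcases l' with _ | ⟨b', l'⟩
    · rfl
    · rw [nameAt_cons, h] at h'
      simp at h'
  | cons b l ih =>
    rw [nameAt_cons] at h
    rcases l' with _ | ⟨b', l'⟩
    · rw [nameAt_nil, h.1] at h'
      simp at h'
    · rw [nameAt_cons, h.1] at h'
      simp only [Option.some.injEq, Letter.bit.injEq] at h'
      rw [h'.1, ih h.2 h'.2]

section Encoding

variable (nr : R → List Bool) (nv : ℕ → List Bool)

/-- The word `w` has the formula `φ` at position `i`. -/
def At (w : List Letter) (i : ℕ) (φ : Formula R) : Prop := φ.encode nr nv <+: w.drop i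

variable {nr nv} {w : List Letter} {i : ℕ}

theorem at_top : At nr nv w i .top ↔ w[i]? = some .top := by
  rw [At, Formula.encode, cons_prefix_drop]
  simp

theorem at_var {p : ℕ} :
    At nr nv w i (.var p) ↔ w[i]? = some .var ∧ NameAt w (i + 1) (nv p) := by
  rw [At, Formula.encode, List.cons_append, cons_prefix_drop]
  rfl

theorem at_and {σ τ : Formula R} : At nr nv w i (.and σ τ) ↔ w[i]? = some .and ∧
    At nr nv w (i + 1) σ ∧ At nr nv w (i + 1 + (σ.encode nr nv).length) τ := by
  rw [At, Formula.encode, List.cons_append, cons_prefix_drop, append_prefix_drop]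
  rfl

theorem at_dia {r : R} {σ : Formula R} : At nr nv w i (.dia r σ) ↔ w[i]? = some .dia ∧
    NameAt w (i + 1) (nr r) ∧ At nr nv w (i + 1 + (nr r).length + 1) σ := by
  have h : Formula.encode nr nv (.dia r σ) =
      .dia :: ((nr r).map .bit ++ [.sep] ++ σ.encode nr nv) := by
    simp [Formula.encode]
  rw [At, h, cons_prefix_drop, append_prefix_drop]
  simp [NameAt, At, add_assoc]

theorem at_of_letter_var {φ : Formula R} (h : At nr nv w i φ) (hw : w[i]? = some .var) :
    ∃ p, φ = .var p := by
  cases φ with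
  | top => rw [at_top, hw] at h; simp at h
  | var p => exact ⟨p, rfl⟩
  | and σ τ => rw [at_and, hw] at h; simp at h
  | dia r σ => rw [at_dia, hw] at h; simp at h

theorem at_of_letter_and {φ : Formula R} (h : At nr nv w i φ) (hw : w[i]? = some .and) :
    ∃ σ τ, φ = .and σ τ := by
  cases φ with
  | top => rw [at_top, hw] at h; simp at h
  | var p => rw [at_var, hw] at h; simp at h
  | and σ τ => exact ⟨σ, τ, rfl⟩
  | dia r σ => rw [at_dia, hw] at h; simp at h

theorem at_of_letter_dia {φ : Formula R} (h : At nr nv w i φ) (hw : w[i]? = some .dia) :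
    ∃ r σ, φ = .dia r σ := by
  cases φ with
  | top => rw [at_top, hw] at h; simp at h
  | var p => rw [at_var, hw] at h; simp at h
  | and σ τ => rw [at_and, hw] at h; simp at h
  | dia r σ => exact ⟨r, σ, rfl⟩

theorem at_of_letter_top {φ : Formula R} (h : At nr nv w i φ) (hw : w[i]? = some .top) :
    φ = .top := by
  cases φ with
  | top => rfl
  | var p => rw [at_var, hw] at h; simp at h
  | and σ τ => rw [at_and, hw] at h; simp at h
  | dia r σ => rw [at_dia, hw] at h; simp at h

theorem length_encode_pos (φ : Formula R) : 0 < (φ.encode nr nv).length := by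
  cases φ <;> simp [Formula.encode]

theorem length_encode_var (p : ℕ) :
    ((Formula.var p : Formula R).encode nr nv).length = (nv p).length + 2 := by
  simp [Formula.encode]

theorem length_encode_and (σ τ : Formula R) : ((Formula.and σ τ).encode nr nv).length =
    (σ.encode nr nv).length + (τ.encode nr nv).length + 1 := by
  simp [Formula.encode]

theorem length_encode_dia (r : R) (σ : Formula R) : ((Formula.dia r σ).encode nr nv).length =
    (nr r).length + (σ.encode nr nv).length + 2 := by
  simp [Formula.encode]; omega

end Encoding

/-! ### Frames that differ in irrelevant relations -/

/-- The frame in which all relations not in `S` are replaced by the full relation. -/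
def Frame.fill (S : Set R) (F : Frame R) : Frame R where
  W := F.W
  nonempty := F.nonempty
  rel r x y := r ∈ S → F.rel r x y

theorem Frame.sat_fill {S : Set R} {F : Frame R} {φ : Formula R} (h : φ.symbols ⊆ S)
    (v : ℕ → Set F.W) (w : F.W) : (F.fill S).Sat v w φ ↔ F.Sat v w φ := by
  induction φ generalizing w with
  | top => exact Iff.rfl
  | var p => exact Iff.rfl
  | and σ τ ihσ ihτ =>
    exact and_congr (ihσ (Set.subset_union_left.trans h) w)
      (ihτ (Set.subset_union_right.trans h) w)
  | dia r σ ih =>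
    have hr : r ∈ S := h (Set.mem_insert _ _)
    exact exists_congr fun w' => and_congr ⟨fun h => h hr, fun h _ => h⟩
      (ih ((Set.subset_insert _ _).trans h) w')

/-- The relation symbols of a set of implications. -/
def axSymbols (Ax : Set (Implication R)) : Set R :=
  ⋃ ι ∈ Ax, (ι.lhs.symbols ∪ ι.rhs.symbols)

theorem finite_axSymbols {Ax : Set (Implication R)} (h : Ax.Finite) : (axSymbols Ax).Finite :=
  h.biUnion fun ι _ => ι.lhs.finite_symbols.union ι.rhs.finite_symbols

/-- A profile may mention symbols that do not occur in the axioms, even infinitely many. Making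
those relations full does not affect validity of the axioms, renders such premises vacuous and
leaves nothing to prove for such conclusions, so finitely many predicates `arr` suffice. -/
theorem validates_fill {Ax : Set (Implication R)} {κ : Implication R} (hκ : κ ∈ Ax)
    (F : Frame R) : (F.fill (axSymbols Ax)).Validates κ ↔ F.Validates κ := by
  have h : κ.lhs.symbols ∪ κ.rhs.symbols ⊆ axSymbols Ax :=
    Set.subset_biUnion_of_mem (u := fun ι : Implication R => ι.lhs.symbols ∪ ι.rhs.symbols) hκ
  refine forall_congr' fun v => forall_congr' fun x => ?_
  exact imp_congr (Frame.sat_fill (F := F) (Set.subset_union_left.trans h) v x)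
    (Frame.sat_fill (F := F) (Set.subset_union_right.trans h) v x)

/-! ### The rules -/

section Rules

open Saturation

variable (nr : R → List Bool) (nv : ℕ → List Bool) (Ax : Set (Implication R))
  (π : Implication R → Profile R)

/-- The final segments of the names of the relation symbols in `Ax`. -/
abbrev NamePart : Type := {l : List Bool // ∃ r ∈ axSymbols Ax, l <:+ nr r}

/-- Binary predicates on the positions of a word. Formulas and names are given by their first
position. Points of the tree of the left formula are represented by position `0` (the root) and by
the positions of the names in its diamonds. -/
inductive Fact : Type
  /-- the last position of a name -/
  | nameEnd
  | nameEq
  | nameIs (l : NamePart nr Ax)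
  /-- the last position of a formula -/
  | fmlEnd
  /-- a subformula of the left formula belongs to a point -/
  | point
  /-- an arrow of the tree, labelled by the name that represents its target -/
  | tree
  /-- an arrow of the closure -/
  | arr (r : axSymbols Ax)
  | sat
  | acc

/-- The variables of the rules. -/
abbrev Var : Type := Fin 6 ⊕ (Σ κ : Ax, (π κ).G.W)

/-- The rules. -/
inductive Rule (O : Set (Obs Letter (Fact nr Ax) (Var Ax π))) :
    Fact nr Ax → Var Ax π → Var Ax π → Prop
  | nameEnd_sep {i} : .letter .sep i ∈ O → Rule O .nameEnd i i
  | nameEnd_bit {i j k} (b : Bool) : .letter (.bit b) i ∈ O → .succ i j ∈ O →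
      .fact .nameEnd j k ∈ O → Rule O .nameEnd i k
  | nameEq_sep {i j} : .letter .sep i ∈ O → .letter .sep j ∈ O → Rule O .nameEq i j
  | nameEq_bit {i j i' j'} (b : Bool) : .letter (.bit b) i ∈ O → .letter (.bit b) j ∈ O →
      .succ i i' ∈ O → .succ j j' ∈ O → .fact .nameEq i' j' ∈ O → Rule O .nameEq i j
  | nameIs_sep {i} (l : NamePart nr Ax) (hl : l.1 = []) : .letter .sep i ∈ O →
      Rule O (.nameIs l) i i
  | nameIs_bit {i j} (b : Bool) (l l' : NamePart nr Ax) (hl : l.1 = b :: l'.1) :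
      .letter (.bit b) i ∈ O → .succ i j ∈ O → .fact (.nameIs l') j j ∈ O → Rule O (.nameIs l) i i
  | fmlEnd_top {i} : .letter .top i ∈ O → Rule O .fmlEnd i i
  | fmlEnd_var {i j k} : .letter .var i ∈ O → .succ i j ∈ O → .fact .nameEnd j k ∈ O →
      Rule O .fmlEnd i k
  | fmlEnd_and {i j k l m} : .letter .and i ∈ O → .succ i j ∈ O → .fact .fmlEnd j k ∈ O →
      .succ k l ∈ O → .fact .fmlEnd l m ∈ O → Rule O .fmlEnd i m
  | fmlEnd_dia {i j k l m} : .letter .dia i ∈ O → .succ i j ∈ O → .fact .nameEnd j k ∈ O →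
      .succ k l ∈ O → .fact .fmlEnd l m ∈ O → Rule O .fmlEnd i m
  | point_root {i} : .first i ∈ O → Rule O .point i i
  | point_left {i j p} : .fact .point i p ∈ O → .letter .and i ∈ O → .succ i j ∈ O →
      Rule O .point j p
  | point_right {i j k l p} : .fact .point i p ∈ O → .letter .and i ∈ O → .succ i j ∈ O →
      .fact .fmlEnd j k ∈ O → .succ k l ∈ O → Rule O .point l p
  | point_dia {i j k l p} : .fact .point i p ∈ O → .letter .dia i ∈ O → .succ i j ∈ O →
      .fact .nameEnd j k ∈ O → .succ k l ∈ O → Rule O .point l j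
  | tree {i j p} : .fact .point i p ∈ O → .letter .dia i ∈ O → .succ i j ∈ O → Rule O .tree p j
  | arr_tree {p q} (r : axSymbols Ax) (l : NamePart nr Ax) (hl : l.1 = nr r) :
      .fact .tree p q ∈ O → .fact (.nameIs l) q q ∈ O → Rule O (.arr r) p q
  -- Premises with symbols outside `axSymbols Ax` are dropped, and a profile whose conclusion has
  -- such a symbol yields no rule.
  | arr_profile (κ : Ax) (e : (π κ).G.W → Var Ax π) (hS : (π κ).S ∈ axSymbols Ax) :
      (∀ (r : axSymbols Ax) x y, (π κ).G.rel r x y → .fact (.arr r) (e x) (e y) ∈ O) →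
        Rule O (.arr ⟨(π κ).S, hS⟩) (e (π κ).u) (e (π κ).v)
  | sat_top {j p} : .letter .top j ∈ O → Rule O .sat j p
  | sat_var {i i' j j' p} : .fact .point i p ∈ O → .letter .var i ∈ O → .succ i i' ∈ O →
      .letter .var j ∈ O → .succ j j' ∈ O → .fact .nameEq i' j' ∈ O → Rule O .sat j p
  | sat_and {i j k l p} : .letter .and i ∈ O → .succ i j ∈ O → .fact .fmlEnd j k ∈ O →
      .succ k l ∈ O → .fact .sat j p ∈ O → .fact .sat l p ∈ O → Rule O .sat i p
  -- Arrows whose symbol does not occur in the axioms are only those of the tree. Their names are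
  -- unbounded in number, so they are compared inside the word by `nameEq` and not stored in a
  -- predicate.
  | sat_tree {i j k l p q} : .letter .dia i ∈ O → .succ i j ∈ O → .fact .nameEnd j k ∈ O →
      .succ k l ∈ O → .fact .tree p q ∈ O → .fact .nameEq q j ∈ O → .fact .sat l q ∈ O →
      Rule O .sat i p
  | sat_arr {i j k l p q} (r : axSymbols Ax) (n : NamePart nr Ax) (hn : n.1 = nr r) :
      .letter .dia i ∈ O → .succ i j ∈ O → .fact .nameEnd j k ∈ O →
      .succ k l ∈ O → .fact (.arr r) p q ∈ O → .fact (.nameIs n) j j ∈ O → .fact .sat l q ∈ O →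
      Rule O .sat i p
  | acc {i k l} : .first i ∈ O → .fact .fmlEnd i k ∈ O → .succ k l ∈ O → .fact .sat l i ∈ O →
      Rule O .acc i i

variable {nr nv Ax π}

theorem Rule.mono {O O' : Set (Obs Letter (Fact nr Ax) (Var Ax π))} (h : O ⊆ O') {p i j}
    (hr : Rule nr Ax π O p i j) : Rule nr Ax π O' p i j := by
  cases hr with
  | nameEnd_sep h1 => exact .nameEnd_sep (h h1)
  | nameEnd_bit b h1 h2 h3 => exact .nameEnd_bit b (h h1) (h h2) (h h3)
  | nameEq_sep h1 h2 => exact .nameEq_sep (h h1) (h h2)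
  | nameEq_bit b h1 h2 h3 h4 h5 => exact .nameEq_bit b (h h1) (h h2) (h h3) (h h4) (h h5)
  | nameIs_sep l hl h1 => exact .nameIs_sep l hl (h h1)
  | nameIs_bit b l l' hl h1 h2 h3 => exact .nameIs_bit b l l' hl (h h1) (h h2) (h h3)
  | fmlEnd_top h1 => exact .fmlEnd_top (h h1)
  | fmlEnd_var h1 h2 h3 => exact .fmlEnd_var (h h1) (h h2) (h h3)
  | fmlEnd_and h1 h2 h3 h4 h5 => exact .fmlEnd_and (h h1) (h h2) (h h3) (h h4) (h h5)
  | fmlEnd_dia h1 h2 h3 h4 h5 => exact .fmlEnd_dia (h h1) (h h2) (h h3) (h h4) (h h5)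
  | point_root h1 => exact .point_root (h h1)
  | point_left h1 h2 h3 => exact .point_left (h h1) (h h2) (h h3)
  | point_right h1 h2 h3 h4 h5 => exact .point_right (h h1) (h h2) (h h3) (h h4) (h h5)
  | point_dia h1 h2 h3 h4 h5 => exact .point_dia (h h1) (h h2) (h h3) (h h4) (h h5)
  | tree h1 h2 h3 => exact .tree (h h1) (h h2) (h h3)
  | arr_tree r l hl h1 h2 => exact .arr_tree r l hl (h h1) (h h2)
  | arr_profile κ e hS h1 => exact .arr_profile κ e hS fun r x y hxy => h (h1 r x y hxy)
  | sat_top h1 => exact .sat_top (h h1)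
  | sat_var h1 h2 h3 h4 h5 h6 => exact .sat_var (h h1) (h h2) (h h3) (h h4) (h h5) (h h6)
  | sat_and h1 h2 h3 h4 h5 h6 => exact .sat_and (h h1) (h h2) (h h3) (h h4) (h h5) (h h6)
  | sat_tree h1 h2 h3 h4 h5 h6 h7 =>
    exact .sat_tree (h h1) (h h2) (h h3) (h h4) (h h5) (h h6) (h h7)
  | sat_arr r n hn h1 h2 h3 h4 h5 h6 h7 =>
    exact .sat_arr r n hn (h h1) (h h2) (h h3) (h h4) (h h5) (h h6) (h h7)
  | acc h1 h2 h3 h4 => exact .acc (h h1) (h h2) (h h3) (h h4)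

/-! ### Soundness of the rules -/

/-- The map `g` from positions to points of a model realises the tree of the formula `φ` at
position `i`, where the root of the tree is represented by position `p`. -/
def Realises (nr : R → List Bool) (nv : ℕ → List Bool) {F : Frame R} (v : ℕ → Set F.W)
    (g : ℕ → F.W) : Formula R → ℕ → ℕ → Prop
  | .top, _, _ => True
  | .var q, _, p => g p ∈ v q
  | .and σ τ, i, p => Realises nr nv v g σ (i + 1) p ∧
      Realises nr nv v g τ (i + 1 + (σ.encode nr nv).length) p
  | .dia r σ, i, p => F.rel r (g p) (g (i + 1)) ∧
      Realises nr nv v g σ (i + 1 + (nr r).length + 1) (i + 1)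

/-- Only the value at the root and the values at positions inside the word of the formula after its
first letter matter. Maps for formulas at disjoint places can therefore be combined. -/
theorem Realises.congr {F : Frame R} {v : ℕ → Set F.W} {g g' : ℕ → F.W} {φ : Formula R} {i p : ℕ}
    (hp : g p = g' p)
    (h : ∀ n, i < n → n < i + (φ.encode nr nv).length → g n = g' n)
    (hg : Realises nr nv v g φ i p) : Realises nr nv v g' φ i p := by
  induction φ generalizing i p with
  | top => trivial
  | var q => simpa only [Realises, hp] using hg
  | and σ τ ihσ ihτ =>
    rw [length_encode_and] at h
    exact ⟨ihσ hp (fun n h1 h2 => h n (by omega) (by omega)) hg.1,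
      ihτ hp (fun n h1 h2 => h n (by omega) (by omega)) hg.2⟩
  | dia r σ ih =>
    rw [length_encode_dia] at h
    have h0 := length_encode_pos (nr := nr) (nv := nv) σ
    have h1 : g (i + 1) = g' (i + 1) := h _ (by omega) (by omega)
    exact ⟨by rw [← hp, ← h1]; exact hg.1,
      ih h1 (fun n h1 h2 => h n (by omega) (by omega)) hg.2⟩

/-- The condition `p ≤ i` keeps the position representing the root apart from the positions that
represent the points below it, so the values can be chosen independently. -/
theorem exists_realises {F : Frame R} {v : ℕ → Set F.W} {φ : Formula R} {y : F.W}
    (h : F.Sat v y φ) {i p : ℕ} (hp : p ≤ i) :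
    ∃ g : ℕ → F.W, g p = y ∧ Realises nr nv v g φ i p := by
  induction φ generalizing y i p with
  | top => exact ⟨fun _ => y, rfl, trivial⟩
  | var q => exact ⟨fun _ => y, rfl, h⟩
  | and σ τ ihσ ihτ =>
    obtain ⟨g₁, h1, hg₁⟩ := ihσ h.1 (i := i + 1) (p := p) (by omega)
    obtain ⟨g₂, h2, hg₂⟩ := ihτ h.2 (i := i + 1 + (σ.encode nr nv).length) (p := p) (by omega)
    refine ⟨fun n => if n < i + 1 + (σ.encode nr nv).length then g₁ n else g₂ n, ?_,
      hg₁.congr ?_ ?_, hg₂.congr ?_ ?_⟩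
    · dsimp only; rw [if_pos (by omega), h1]
    · rw [if_pos (by omega)]
    · intro n _ h4; rw [if_pos h4]
    · rw [if_pos (by omega), h1, h2]
    · intro n h3 _; rw [if_neg (by omega)]
  | dia r σ ih =>
    obtain ⟨y', hr, h⟩ := h
    obtain ⟨g, h1, hg⟩ := ih h (i := i + 1 + (nr r).length + 1) (p := i + 1) (by omega)
    refine ⟨fun n => if n = p then y else g n, if_pos rfl, ?_, hg.congr ?_ ?_⟩
    · dsimp only; rw [if_pos rfl, if_neg (by omega), h1]; exact hr
    · rw [if_neg (by omega)]
    · intro n h3 _; rw [if_neg (by omega)]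

/-- The meaning of the facts for a model realising the tree of the left formula. -/
def Meaning (nr : R → List Bool) (nv : ℕ → List Bool) (w : List Letter) {F : Frame R}
    (v : ℕ → Set F.W) (g : ℕ → F.W) (τ : Formula R) : Fact nr Ax → ℕ → ℕ → Prop
  | .nameEnd, i, j => ∀ l, NameAt w i l → j = i + l.length
  | .nameEq, i, j => ∀ l l', NameAt w i l → NameAt w j l' → l = l'
  | .nameIs n, i, _ => ∀ l, NameAt w i l → l = n.1
  | .fmlEnd, i, j => ∀ φ, At nr nv w i φ → j + 1 = i + (φ.encode nr nv).length
  | .point, i, p => ∃ φ, At nr nv w i φ ∧ Realises nr nv v g φ i p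
  | .tree, p, q => ∃ r, NameAt w q (nr r) ∧ F.rel r (g p) (g q)
  | .arr r, p, q => F.rel r (g p) (g q)
  | .sat, j, p => ∀ φ, At nr nv w j φ → F.Sat v (g p) φ
  | .acc, _, _ => F.Sat v (g 0) τ

/-- The facts that are true of one given model form a closed set, so a fact contained in every
closed set is true of every model of the axioms realising `σ`. The meanings of the parsing facts are
conditional on a name or formula being present, so rules applied at meaningless positions do no
harm. -/
theorem closed_meaning (hnr : Function.Injective nr) (hnv : Function.Injective nv)
    (hπ : ∀ ι ∈ Ax, (π ι).IsProfileOf ι) {w : List Letter} {F : Frame R} (hF : F.IsFrameFor Ax)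
    {v : ℕ → Set F.W} {g : ℕ → F.W} {σ τ : Formula R} (hσ : At nr nv w 0 σ)
    (hτ : At nr nv w (σ.encode nr nv).length τ) (hg : Realises nr nv v g σ 0 0) :
    Closed (Rule nr Ax π) w {f | Meaning nr nv w v g τ f.1 f.2.1 f.2.2} := by
  intro x hx p i j hr
  cases hr with
  | nameEnd_sep h1 =>
    intro l hl
    rw [(hl.unique (nameAt_nil.2 h1) : l = [])]
    rfl
  | nameEnd_bit b h1 h2 h3 =>
    rintro (_ | ⟨b', l⟩) hl
    · rw [nameAt_nil] at hl
      cases hl.symm.trans h1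
    · rw [nameAt_cons] at hl
      have h2 : _ + 1 = _ := h2
      have h := h3 l (h2 ▸ hl.2)
      simp only [List.length_cons] at h ⊢
      omega
  | nameEq_sep h1 h2 =>
    intro l l' hl hl'
    rw [hl.unique (nameAt_nil.2 h1), hl'.unique (nameAt_nil.2 h2)]
  | nameEq_bit b h1 h2 h3 h4 h5 =>
    rintro (_ | ⟨c, l⟩) (_ | ⟨c', l'⟩) hl hl'
    · rfl
    · rw [nameAt_nil] at hl
      cases hl.symm.trans h1
    · rw [nameAt_nil] at hl'
      cases hl'.symm.trans h2
    · rw [nameAt_cons] at hl hl'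
      have h3 : _ + 1 = _ := h3
      have h4 : _ + 1 = _ := h4
      have e1 := Option.some_inj.1 (hl.1.symm.trans h1)
      have e2 := Option.some_inj.1 (hl'.1.symm.trans h2)
      simp only [Letter.bit.injEq] at e1 e2
      rw [e1, e2, h5 l l' (h3 ▸ hl.2) (h4 ▸ hl'.2)]
  | nameIs_sep n hn h1 =>
    intro l hl
    rw [hl.unique (nameAt_nil.2 h1)]
    exact hn.symm
  | nameIs_bit b n n' hn h1 h2 h3 =>
    rintro (_ | ⟨c, l⟩) hl
    · rw [nameAt_nil] at hl
      cases hl.symm.trans h1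
    · rw [nameAt_cons] at hl
      have h2 : _ + 1 = _ := h2
      have e1 := Option.some_inj.1 (hl.1.symm.trans h1)
      simp only [Letter.bit.injEq] at e1
      show _ = n.1
      rw [hn, e1, h3 l (h2 ▸ hl.2)]
  | fmlEnd_top h1 =>
    intro φ hφ
    rw [at_of_letter_top hφ h1]
    rfl
  | fmlEnd_var h1 h2 h3 =>
    intro φ hφ
    obtain ⟨q, rfl⟩ := at_of_letter_var hφ h1
    have h2 : _ + 1 = _ := h2
    have h := h3 _ (h2 ▸ (at_var.1 hφ).2)
    rw [length_encode_var]
    simp only at h ⊢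
    omega
  | fmlEnd_and h1 h2 h3 h4 h5 =>
    intro φ hφ
    obtain ⟨ρ, ψ, rfl⟩ := at_of_letter_and hφ h1
    obtain ⟨-, ha, hb⟩ := at_and.1 hφ
    have h2 : _ + 1 = _ := h2
    have h4 : _ + 1 = _ := h4
    simp only at hφ ha hb
    rw [h2] at ha hb
    have h := h3 _ ha
    simp only at h
    rw [← h, h4] at hb
    have h' := h5 _ hb
    rw [length_encode_and]
    simp only at h' ⊢
    omega
  | fmlEnd_dia h1 h2 h3 h4 h5 =>
    intro φ hφ
    obtain ⟨r, ψ, rfl⟩ := at_of_letter_dia hφ h1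
    obtain ⟨-, ha, hb⟩ := at_dia.1 hφ
    have h2 : _ + 1 = _ := h2
    have h4 : _ + 1 = _ := h4
    simp only at hφ ha hb
    rw [h2] at ha hb
    have h := h3 _ ha
    simp only at h
    rw [← h, h4] at hb
    have h' := h5 _ hb
    rw [length_encode_dia]
    simp only at h' ⊢
    omega
  | point_root h1 =>
    have h1 : x i = 0 := h1
    show ∃ φ, _
    simp only [h1]
    exact ⟨σ, hσ, hg⟩
  | point_left h1 h2 h3 =>
    obtain ⟨φ, hφ, hgφ⟩ := h1
    obtain ⟨ρ, ψ, rfl⟩ := at_of_letter_and hφ h2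
    have h3 : _ + 1 = _ := h3
    exact ⟨ρ, h3 ▸ (at_and.1 hφ).2.1, h3 ▸ hgφ.1⟩
  | point_right h1 h2 h3 h4 h5 =>
    obtain ⟨φ, hφ, hgφ⟩ := h1
    obtain ⟨ρ, ψ, rfl⟩ := at_of_letter_and hφ h2
    obtain ⟨-, ha, hb⟩ := at_and.1 hφ
    have hc := hgφ.2
    have h3 : _ + 1 = _ := h3
    have h5 : _ + 1 = _ := h5
    simp only at ha hb hc
    rw [h3] at ha hb hc
    have h := h4 _ ha
    simp only at h
    rw [← h, h5] at hb hc
    exact ⟨ψ, hb, hc⟩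
  | point_dia h1 h2 h3 h4 h5 =>
    obtain ⟨φ, hφ, hgφ⟩ := h1
    obtain ⟨r, ψ, rfl⟩ := at_of_letter_dia hφ h2
    obtain ⟨-, ha, hb⟩ := at_dia.1 hφ
    have hc := hgφ.2
    have h3 : _ + 1 = _ := h3
    have h5 : _ + 1 = _ := h5
    simp only at ha hb hc
    rw [h3] at ha hb hc
    have h := h4 _ ha
    simp only at h
    rw [← h, h5] at hb hc
    exact ⟨ψ, hb, hc⟩
  | tree h1 h2 h3 =>
    obtain ⟨φ, hφ, hgφ⟩ := h1
    obtain ⟨r, ψ, rfl⟩ := at_of_letter_dia hφ h2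
    have h3 : _ + 1 = _ := h3
    exact ⟨r, h3 ▸ (at_dia.1 hφ).2.1, h3 ▸ hgφ.1⟩
  | arr_tree r l hl h1 h2 =>
    obtain ⟨r', ha, hb⟩ := h1
    have h : nr r' = l.1 := h2 _ ha
    rw [hl] at h
    rw [hnr h] at hb
    exact hb
  | arr_profile κ e hS h1 =>
    -- The profile is applied in the filled frame, where the premises dropped from the rule hold by
    -- themselves.
    have h2 := (hπ κ κ.2 (F.fill (axSymbols Ax))).1
      ((validates_fill κ.2 F).2 (hF κ κ.2)) (fun a => g (x (e a)))
      (fun r a b hab hr => h1 ⟨r, hr⟩ a b hab)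
    exact h2 hS
  | sat_top h1 =>
    intro φ hφ
    rw [at_of_letter_top hφ h1]
    trivial
  | sat_var h1 h2 h3 h4 h5 h6 =>
    intro φ hφ
    obtain ⟨q, rfl⟩ := at_of_letter_var hφ h4
    obtain ⟨φ', hφ', hgφ⟩ := h1
    obtain ⟨q', rfl⟩ := at_of_letter_var hφ' h2
    have h3 : _ + 1 = _ := h3
    have h5 : _ + 1 = _ := h5
    have h := h6 _ _ (h3 ▸ (at_var.1 hφ').2) (h5 ▸ (at_var.1 hφ).2)
    rw [← hnv h]
    exact hgφ
  | sat_and h1 h2 h3 h4 h5 h6 =>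
    intro φ hφ
    obtain ⟨ρ, ψ, rfl⟩ := at_of_letter_and hφ h1
    obtain ⟨-, ha, hb⟩ := at_and.1 hφ
    have h2 : _ + 1 = _ := h2
    have h4 : _ + 1 = _ := h4
    simp only at hφ ha hb
    rw [h2] at ha hb
    have h := h3 _ ha
    simp only at h
    rw [← h, h4] at hb
    exact ⟨h5 _ ha, h6 _ hb⟩
  | sat_tree h1 h2 h3 h4 h5 h6 h7 =>
    intro φ hφ
    obtain ⟨r, ψ, rfl⟩ := at_of_letter_dia hφ h1
    obtain ⟨-, ha, hb⟩ := at_dia.1 hφ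
    have h2 : _ + 1 = _ := h2
    have h4 : _ + 1 = _ := h4
    simp only at hφ ha hb
    rw [h2] at ha hb
    have h := h3 _ ha
    simp only at h
    rw [← h, h4] at hb
    obtain ⟨r', hc, hd⟩ := h5
    rw [hnr (h6 _ _ hc ha)] at hd
    exact ⟨_, hd, h7 _ hb⟩
  | sat_arr r' n hn h1 h2 h3 h4 h5 h6 h7 =>
    intro φ hφ
    obtain ⟨r, ψ, rfl⟩ := at_of_letter_dia hφ h1
    obtain ⟨-, ha, hb⟩ := at_dia.1 hφ
    have h2 : _ + 1 = _ := h2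
    have h4 : _ + 1 = _ := h4
    simp only at hφ ha hb
    rw [h2] at ha hb
    have h := h3 _ ha
    simp only at h
    rw [← h, h4] at hb
    have hr : nr r = n.1 := h6 _ ha
    rw [hn] at hr
    rw [hnr hr]
    exact ⟨_, h5, h7 _ hb⟩
  | acc h1 h2 h3 h4 =>
    have h1 : x i = 0 := h1
    have h3 : _ + 1 = _ := h3
    have h := h2 σ (by simpa only [h1] using hσ)
    simp only [h1, zero_add] at h
    rw [h] at h3
    have h' := h4 τ (by simpa only [← h3] using hτ)
    simp only [h1] at h'
    exact h'

end Rules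

end SPLogic

/-! ### Completeness of the rules, and the theorem -/

namespace SPLogic

variable {R : Type}

/-! ### Completeness of the rules -/

theorem lt_of_letter {w : List Letter} {i : ℕ} {a : Letter} (h : w[i]? = some a) :
    i < w.length := (List.getElem?_eq_some_iff.1 h).1

theorem NameAt.letter_sep {w : List Letter} {i : ℕ} {l : List Bool} (h : NameAt w i l) :
    w[i + l.length]? = some .sep := by
  induction l generalizing i with
  | nil => exact nameAt_nil.1 h
  | cons b l ih =>
    rw [nameAt_cons] at h
    rw [List.length_cons, add_comm l.length, ← add_assoc]
    exact ih h.2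

theorem NameAt.lt {w : List Letter} {i : ℕ} {l : List Bool} (h : NameAt w i l) :
    i + l.length < w.length := lt_of_letter h.letter_sep

section

open Saturation

variable {nr : R → List Bool} {nv : ℕ → List Bool} {Ax : Set (Implication R)}
  {π : Implication R → Profile R} {w : List Letter} {D : Set (Fact nr Ax × ℕ × ℕ)}

theorem At.le {i : ℕ} {φ : Formula R} (h : At nr nv w i φ) :
    i + (φ.encode nr nv).length ≤ w.length := by
  have h1 := List.IsPrefix.length_le h
  rw [List.length_drop] at h1
  have h2 := length_encode_pos (nr := nr) (nv := nv) φ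
  omega

theorem At.lt {i : ℕ} {φ : Formula R} (h : At nr nv w i φ) : i < w.length := by
  have h1 := At.le h
  have h2 := length_encode_pos (nr := nr) (nv := nv) φ
  omega

/-- Each rule other than `arr_profile` needs at most six positions. The variables belonging to
profiles play no role and receive a default value inside the word. -/
theorem closed_apply (hD : Closed (Rule nr Ax π) w D) {a b c d e f : ℕ} (ha : a < w.length)
    (hb : b < w.length) (hc : c < w.length) (hd : d < w.length) (he : e < w.length)
    (hf : f < w.length) {p : Fact nr Ax} (i j : Fin 6)
    (h : Rule nr Ax π {o | o.Holds w D (Sum.elim ![a, b, c, d, e, f] fun _ => a)} p (.inl i)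
      (.inl j)) : (p, ![a, b, c, d, e, f] i, ![a, b, c, d, e, f] j) ∈ D := by
  refine hD _ ?_ p _ _ h
  rintro (i | s)
  · fin_cases i <;> assumption
  · exact ha

variable (hD : Closed (Rule nr Ax π) w D)

include hD

theorem nameEnd_mem {i : ℕ} {l : List Bool} (h : NameAt w i l) :
    (Fact.nameEnd, i, i + l.length) ∈ D := by
  have hlt := h.lt
  induction l generalizing i with
  | nil =>
    have hi : i < w.length := by omega
    exact closed_apply hD hi hi hi hi hi hi 0 0 (.nameEnd_sep (nameAt_nil.1 h))
  | cons b l ih =>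
    rw [nameAt_cons] at h
    have h1 := ih h.2 h.2.lt
    rw [List.length_cons, add_comm l.length, ← add_assoc]
    have hi : i < w.length := lt_of_letter h.1
    exact closed_apply hD hi (b := i + 1) (by have := h.2.lt; omega) h.2.lt hi hi hi 0 2
      (.nameEnd_bit (j := .inl 1) b h.1 (rfl : i + 1 = i + 1) h1)

theorem nameEq_mem {i j : ℕ} {l : List Bool} (h : NameAt w i l) (h' : NameAt w j l) :
    (Fact.nameEq, i, j) ∈ D := by
  have hi : i < w.length := by have := h.lt; omega
  have hj : j < w.length := by have := h'.lt; omega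
  induction l generalizing i j with
  | nil =>
    exact closed_apply hD hi hj hi hi hi hi 0 1
      (.nameEq_sep (nameAt_nil.1 h) (nameAt_nil.1 h'))
  | cons b l ih =>
    rw [nameAt_cons] at h h'
    have hi' : i + 1 < w.length := by have := h.2.lt; omega
    have hj' : j + 1 < w.length := by have := h'.2.lt; omega
    exact closed_apply hD hi hj hi' hj' hi hi 0 1
      (.nameEq_bit (i' := .inl 2) (j' := .inl 3) b h.1 h'.1 (rfl : i + 1 = i + 1)
        (rfl : j + 1 = j + 1) (ih h.2 h'.2 hi' hj'))

theorem nameIs_mem {i : ℕ} {l : List Bool} (hl : ∃ r ∈ axSymbols Ax, l <:+ nr r)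
    (h : NameAt w i l) : (Fact.nameIs ⟨l, hl⟩, i, i) ∈ D := by
  have hi : i < w.length := by have := h.lt; omega
  induction l generalizing i with
  | nil =>
    exact closed_apply hD hi hi hi hi hi hi 0 0 (.nameIs_sep _ rfl (nameAt_nil.1 h))
  | cons b l ih =>
    rw [nameAt_cons] at h
    have hi' : i + 1 < w.length := by have := h.2.lt; omega
    have hl' : ∃ r ∈ axSymbols Ax, l <:+ nr r :=
      hl.imp fun r hr => ⟨hr.1, (List.suffix_cons b l).trans hr.2⟩
    exact closed_apply hD hi hi' hi hi hi hi 0 0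
      (.nameIs_bit (j := .inl 1) b _ ⟨l, hl'⟩ rfl h.1 (rfl : i + 1 = i + 1) (ih hl' h.2 hi'))

theorem fmlEnd_mem {i : ℕ} {φ : Formula R} (h : At nr nv w i φ) :
    (Fact.fmlEnd, i, i + (φ.encode nr nv).length - 1) ∈ D := by
  have hi : i < w.length := h.lt
  have hle := At.le h
  induction φ generalizing i with
  | top => exact closed_apply hD hi hi hi hi hi hi 0 0 (.fmlEnd_top (at_top.1 h))
  | var p =>
    obtain ⟨h1, h2⟩ := at_var.1 h
    have hlt := h2.lt
    rw [length_encode_var, show i + ((nv p).length + 2) - 1 = i + 1 + (nv p).length by omega]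
    exact closed_apply hD hi (b := i + 1) (by omega) hlt hi hi hi 0 2
      (.fmlEnd_var (j := .inl 1) h1 (rfl : i + 1 = i + 1) (nameEnd_mem hD h2))
  | and σ τ ihσ ihτ =>
    obtain ⟨h1, h2, h3⟩ := at_and.1 h
    have h4 := ihσ h2 h2.lt (At.le h2)
    have h5 := ihτ h3 h3.lt (At.le h3)
    have hσ := length_encode_pos (nr := nr) (nv := nv) σ
    have hτ := length_encode_pos (nr := nr) (nv := nv) τ
    rw [length_encode_and] at hle ⊢
    rw [show i + ((σ.encode nr nv).length + (τ.encode nr nv).length + 1) - 1 =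
      i + 1 + (σ.encode nr nv).length + (τ.encode nr nv).length - 1 by omega]
    exact closed_apply hD hi h2.lt (c := i + 1 + (σ.encode nr nv).length - 1) (by omega) h3.lt
      (e := i + 1 + (σ.encode nr nv).length + (τ.encode nr nv).length - 1) (by omega) hi 0 4
      (.fmlEnd_and (j := .inl 1) (k := .inl 2) (l := .inl 3) h1 (rfl : i + 1 = i + 1) h4
        (by omega : i + 1 + (σ.encode nr nv).length - 1 + 1 = i + 1 + (σ.encode nr nv).length) h5)
  | dia r σ ih =>
    obtain ⟨h1, h2, h3⟩ := at_dia.1 h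
    have h5 := ih h3 h3.lt (At.le h3)
    have hσ := length_encode_pos (nr := nr) (nv := nv) σ
    rw [length_encode_dia] at hle ⊢
    rw [show i + ((nr r).length + (σ.encode nr nv).length + 2) - 1 =
      i + 1 + (nr r).length + 1 + (σ.encode nr nv).length - 1 by omega]
    exact closed_apply hD hi (b := i + 1) (by omega) h2.lt h3.lt
      (e := i + 1 + (nr r).length + 1 + (σ.encode nr nv).length - 1) (by omega) hi 0 4
      (.fmlEnd_dia (j := .inl 1) (k := .inl 2) (l := .inl 3) h1 (rfl : i + 1 = i + 1)
        (nameEnd_mem hD h2)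
        (rfl : i + 1 + (nr r).length + 1 = i + 1 + (nr r).length + 1) h5)

omit hD

/-- The frame on the positions of a word described by a set of facts. -/
def factFrame (hw : 0 < w.length) (D : Set (Fact nr Ax × ℕ × ℕ)) : Frame R where
  W := Fin w.length
  nonempty := ⟨⟨0, hw⟩⟩
  rel r a b := (∃ h : r ∈ axSymbols Ax, (Fact.arr ⟨r, h⟩, (a : ℕ), (b : ℕ)) ∈ D) ∨
    ((Fact.tree, (a : ℕ), (b : ℕ)) ∈ D ∧ NameAt w b (nr r))

/-- The valuation on the positions of a word described by a set of facts. -/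
def factVal (nv : ℕ → List Bool) (w : List Letter) (D : Set (Fact nr Ax × ℕ × ℕ)) (q : ℕ) :
    Set (Fin w.length) :=
  {p | ∃ i, (Fact.point, i, (p : ℕ)) ∈ D ∧ w[i]? = some .var ∧ NameAt w (i + 1) (nv q)}

include hD

/-- For a symbol of the axioms, `arr_tree` has already recorded the tree arrows among the facts
`arr`, so the second disjunct in `factFrame` matters only for the other symbols. -/
theorem arr_mem (hw : 0 < w.length) {r : R} (hr : r ∈ axSymbols Ax) {a b : Fin w.length}
    (h : (factFrame hw D).rel r a b) : (Fact.arr ⟨r, hr⟩, (a : ℕ), (b : ℕ)) ∈ D := by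
  rcases h with ⟨_, h⟩ | ⟨h, hb⟩
  · exact h
  · have hn := nameIs_mem hD ⟨r, hr, List.suffix_refl _⟩ hb
    exact closed_apply hD a.2 b.2 a.2 a.2 a.2 a.2 0 1 (.arr_tree ⟨r, hr⟩ _ rfl h hn)

theorem factFrame_isFrameFor (hπ : ∀ ι ∈ Ax, (π ι).IsProfileOf ι) (hw : 0 < w.length) :
    (factFrame hw D).IsFrameFor Ax := by
  classical
  intro κ hκ
  refine (validates_fill hκ (factFrame hw D)).1 ((hπ κ hκ _).2 fun h hh hS => ?_)
  let h' : (π κ).G.W → Fin w.length := h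
  -- The points of the profile of `κ` are sent to their images under `h`, all other variables to
  -- `0`. The cast identifies the summand belonging to `κ`.
  let x : Var Ax π → ℕ := Sum.elim (fun _ => 0)
    fun s => if hs : s.1 = ⟨κ, hκ⟩ then (h' (cast (congrArg (fun κ : Ax => (π κ).G.W) hs) s.2) : ℕ) else 0
  have hx : ∀ a : (π κ).G.W, x (.inr ⟨⟨κ, hκ⟩, a⟩) = h' a := fun a => by simp [x]
  refine Or.inl ⟨hS, ?_⟩
  have := hD x ?_ _ _ _ (.arr_profile ⟨κ, hκ⟩ (fun a => .inr ⟨⟨κ, hκ⟩, a⟩) hS fun r a b hab => ?_)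
  · rw [hx, hx] at this
    exact this
  · rintro (i | s)
    · exact hw
    · simp only [x, Sum.elim_inr]
      split_ifs
      · exact (h' _).2
      · exact hw
  · show (_, x _, x _) ∈ D
    rw [hx, hx]
    exact arr_mem hD hw r.2 (hh r a b hab r.2)

/-- The rules for `point` and `tree` unfold the tree of the formula inside any closed set of facts.
At the start of the word this makes the left formula true at position `0`. -/
theorem sat_of_point (hw : 0 < w.length) {φ : Formula R} {i : ℕ} {p : Fin w.length}
    (h : At nr nv w i φ) (hp : (Fact.point, i, (p : ℕ)) ∈ D) :
    (factFrame hw D).Sat (factVal nv w D) p φ := by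
  induction φ generalizing i p with
  | top => trivial
  | var q => exact ⟨i, hp, at_var.1 h⟩
  | and σ τ ihσ ihτ =>
    have hi : i < w.length := h.lt
    obtain ⟨h1, h2, h3⟩ := at_and.1 h
    have hle := At.le h2
    have hσ := length_encode_pos (nr := nr) (nv := nv) σ
    refine ⟨ihσ h2 ?_, ihτ h3 ?_⟩
    · exact closed_apply hD hi h2.lt p.2 hi hi hi 1 2
        (.point_left (i := .inl 0) hp h1 (rfl : i + 1 = i + 1))
    · exact closed_apply hD hi h2.lt p.2 (d := i + 1 + (σ.encode nr nv).length - 1) (by omega)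
        h3.lt hi 4 2
        (.point_right (i := .inl 0) (j := .inl 1) (k := .inl 3) hp h1 (rfl : i + 1 = i + 1)
          (fmlEnd_mem hD h2)
          (by omega : i + 1 + (σ.encode nr nv).length - 1 + 1 = i + 1 + (σ.encode nr nv).length))
  | dia r σ ih =>
    have hi : i < w.length := h.lt
    obtain ⟨h1, h2, h3⟩ := at_dia.1 h
    have hn : i + 1 < w.length := by have := h2.lt; omega
    refine ⟨(⟨i + 1, hn⟩ : Fin w.length), Or.inr ⟨?_, h2⟩, ih h3 ?_⟩
    · exact closed_apply hD hi hn p.2 hi hi hi 2 1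
        (.tree (i := .inl 0) hp h1 (rfl : i + 1 = i + 1))
    · exact closed_apply hD hi hn p.2 h2.lt h3.lt hi 4 1
        (.point_dia (i := .inl 0) (k := .inl 3) (p := .inl 2) hp h1 (rfl : i + 1 = i + 1)
          (nameEnd_mem hD h2)
          (rfl : i + 1 + (nr r).length + 1 = i + 1 + (nr r).length + 1))

/-- The converse passage, from truth in the frame of facts back to facts: each clause of the truth
definition is matched by a `sat` rule, with one rule for each of the two kinds of arrows. -/
theorem sat_mem (hw : 0 < w.length) {φ : Formula R} {j : ℕ} {p : Fin w.length}
    (hs : (factFrame hw D).Sat (factVal nv w D) p φ) (h : At nr nv w j φ) :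
    (Fact.sat, j, (p : ℕ)) ∈ D := by
  induction φ generalizing j p with
  | top =>
    exact closed_apply hD h.lt p.2 p.2 p.2 p.2 p.2 0 1 (.sat_top (at_top.1 h))
  | var q =>
    obtain ⟨i, hi, hv, hn⟩ := hs
    obtain ⟨h1, h2⟩ := at_var.1 h
    have hi' := hn.lt
    have hj' := h2.lt
    exact closed_apply hD (lt_of_letter hv) (b := i + 1) (by omega) h.lt (d := j + 1) (by omega)
      p.2 p.2 2 4
      (.sat_var (i := .inl 0) (i' := .inl 1) (j' := .inl 3) hi hv (rfl : i + 1 = i + 1) h1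
        (rfl : j + 1 = j + 1) (nameEq_mem hD hn h2))
  | and σ τ ihσ ihτ =>
    obtain ⟨h1, h2, h3⟩ := at_and.1 h
    have hle := At.le h2
    have hσ := length_encode_pos (nr := nr) (nv := nv) σ
    exact closed_apply hD h.lt h2.lt (c := j + 1 + (σ.encode nr nv).length - 1) (by omega)
      h3.lt p.2 p.2 0 4
      (.sat_and (j := .inl 1) (k := .inl 2) (l := .inl 3) h1 (rfl : j + 1 = j + 1)
        (fmlEnd_mem hD h2)
        (by omega : j + 1 + (σ.encode nr nv).length - 1 + 1 = j + 1 + (σ.encode nr nv).length)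
        (ihσ hs.1 h2) (ihτ hs.2 h3))
  | dia r σ ih =>
    obtain ⟨h1, h2, h3⟩ := at_dia.1 h
    obtain ⟨q, hr, hq⟩ := hs
    have hn : j + 1 < w.length := by have := h2.lt; omega
    have hj : j < w.length := h.lt
    rcases hr with ⟨hr, ha⟩ | ⟨ht, hb⟩
    · exact closed_apply hD hj hn h2.lt h3.lt p.2 q.2 0 4
        (.sat_arr (j := .inl 1) (k := .inl 2) (l := .inl 3) (q := .inl 5) ⟨r, hr⟩
          ⟨nr r, r, hr, List.suffix_refl _⟩ rfl h1 (rfl : j + 1 = j + 1) (nameEnd_mem hD h2)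
          (rfl : j + 1 + (nr r).length + 1 = j + 1 + (nr r).length + 1) ha
          (nameIs_mem hD _ h2) (ih hq h3))
    · exact closed_apply hD hj hn h2.lt h3.lt p.2 q.2 0 4
        (.sat_tree (j := .inl 1) (k := .inl 2) (l := .inl 3) (q := .inl 5) h1
          (rfl : j + 1 = j + 1) (nameEnd_mem hD h2)
          (rfl : j + 1 + (nr r).length + 1 = j + 1 + (nr r).length + 1) ht
          (nameEq_mem hD hb h2) (ih hq h3))

theorem acc_mem (hπ : ∀ ι ∈ Ax, (π ι).IsProfileOf ι) {σ τ : Formula R}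
    (hσ : At nr nv w 0 σ) (hτ : At nr nv w (σ.encode nr nv).length τ)
    (h : KrConsequence Ax ⟨σ, τ⟩) : (Fact.acc, 0, 0) ∈ D := by
  have hw : 0 < w.length := hσ.lt
  have hroot : (Fact.point, 0, 0) ∈ D :=
    closed_apply hD hw hw hw hw hw hw 0 0 (.point_root (rfl : 0 = 0))
  have h1 := h _ (factFrame_isFrameFor hD hπ hw) (factVal nv w D) (⟨0, hw⟩ : Fin w.length)
    (sat_of_point hD hw hσ hroot)
  have h2 := sat_mem hD hw h1 hτ
  have hpos := length_encode_pos (nr := nr) (nv := nv) σ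
  have hlt := At.lt hτ
  have hend := fmlEnd_mem hD hσ
  rw [zero_add] at hend
  exact closed_apply hD hw (b := (σ.encode nr nv).length - 1) (by omega) hlt hw hw hw 0 0
    (.acc (k := .inl 1) (l := .inl 2) (rfl : 0 = 0) hend
      (by omega : (σ.encode nr nv).length - 1 + 1 = (σ.encode nr nv).length) h2)

omit hD

theorem krConsequence_iff_closed (hnr : Function.Injective nr) (hnv : Function.Injective nv)
    (hπ : ∀ ι ∈ Ax, (π ι).IsProfileOf ι) (ι : Implication R) :
    KrConsequence Ax ι ↔
      ∀ D, Closed (Rule nr Ax π) (ι.encode nr nv) D → (Fact.acc, 0, 0) ∈ D := by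
  obtain ⟨σ, τ⟩ := ι
  have hσ : At nr nv (Implication.encode nr nv ⟨σ, τ⟩) 0 σ := List.prefix_append _ _
  have hτ : At nr nv (Implication.encode nr nv ⟨σ, τ⟩) (σ.encode nr nv).length τ := by
    simp [At, Implication.encode]
  refine ⟨fun h D hD => acc_mem hD hπ hσ hτ h, fun h F hF v y hy => ?_⟩
  obtain ⟨g, rfl, hg⟩ := exists_realises (nr := nr) (nv := nv) hy (le_refl 0)
  -- The closed set used is that of the facts true in the given model; its `acc` fact says that `τ`
  -- holds at `g 0`.
  exact h _ (closed_meaning hnr hnv hπ hF hσ hτ hg)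

end

/-! ### Decidability -/

instance : Inhabited Letter := ⟨.top⟩

instance : Finite Letter :=
  Finite.of_injective (β := Option (Option (Option (Option (Option Bool)))))
    (fun
      | .top => none
      | .and => some none
      | .dia => some (some none)
      | .var => some (some (some none))
      | .sep => some (some (some (some none)))
      | .bit b => some (some (some (some (some b)))))
    (fun a b h => by cases a <;> cases b <;> simp_all)

theorem finite_namePart (nr : R → List Bool) {Ax : Set (Implication R)} (h : Ax.Finite) :
    Finite (NamePart nr Ax) := by
  have : {l : List Bool | ∃ r ∈ axSymbols Ax, l <:+ nr r} =
      ⋃ r ∈ axSymbols Ax, {l | l ∈ (nr r).tails} := by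
    ext l; simp
  have hfin : {l : List Bool | ∃ r ∈ axSymbols Ax, l <:+ nr r}.Finite := by
    rw [this]
    exact (finite_axSymbols h).biUnion fun r _ => (nr r).tails.finite_toSet
  exact hfin.to_subtype

theorem finite_fact (nr : R → List Bool) {Ax : Set (Implication R)} (h : Ax.Finite) :
    Finite (Fact nr Ax) := by
  have := finite_namePart nr h
  have := (finite_axSymbols h).to_subtype
  exact Finite.of_injective (β := Fin 7 ⊕ NamePart nr Ax ⊕ axSymbols Ax)
    (fun
      | .nameEnd => .inl 0
      | .nameEq => .inl 1
      | .nameIs l => .inr (.inl l)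
      | .fmlEnd => .inl 2
      | .point => .inl 3
      | .tree => .inl 4
      | .arr r => .inr (.inr r)
      | .sat => .inl 5
      | .acc => .inl 6)
    (fun a b h => by cases a <;> cases b <;> simp_all)

theorem decidableInPTime_krConsequence {Ax : Set (Implication R)} (hfin : Ax.Finite)
    {π : Implication R → Profile R} (hπ : ∀ ι ∈ Ax, (π ι).IsProfileOf ι)
    {nr : R → List Bool} {nv : ℕ → List Bool} (hnr : Function.Injective nr)
    (hnv : Function.Injective nv) :
    DecidableInPTime (Implication.encode nr nv) {ι : Implication R | KrConsequence Ax ι} := by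
  have := finite_fact nr hfin
  have := hfin.to_subtype
  have := fun κ : Ax => (π κ).finite
  have : Finite (Var Ax π) := inferInstance
  refine Saturation.decidableInPTime (Rule nr Ax π) (fun O O' h p i j => Rule.mono h) .acc _ _
    (fun ι => ?_) (krConsequence_iff_closed hnr hnv hπ)
  have h1 := length_encode_pos (nr := nr) (nv := nv) ι.lhs
  have h2 := length_encode_pos (nr := nr) (nv := nv) ι.rhs
  rw [Implication.encode, List.length_append]
  omega

instance [h : Nonempty R] : Nonempty (Profile R) :=
  h.map fun r =>
    ⟨⟨Unit, ⟨()⟩, fun _ _ _ => False⟩, inferInstanceAs (Finite Unit), ⟨(), fun _ => .refl⟩, r,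
      (), (), id⟩

end SPLogic

theorem mainTheorem10 {R : Type} [Nonempty R] (Ax : Set (SPLogic.Implication R))
    (hfin : Ax.Finite) (hHorn : ∀ ι ∈ Ax, SPLogic.IsHorn ι) :
    SPLogic.HasPolyFiniteFrameProperty (SPLogic.SPi Ax) ∧
    (∀ π : SPLogic.Implication R → SPLogic.Profile R, (∀ ι ∈ Ax, (π ι).IsProfileOf ι) →
      ∀ σ τ : SPLogic.Formula R,
        SPLogic.KrConsequence Ax ⟨σ, τ⟩ ↔
          (σ.tree.closure (π '' Ax)).Sat σ.treeVal none τ) ∧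
    (SPLogic.IsComplete Ax →
      ∀ (nr : R → List Bool) (nv : ℕ → List Bool),
        Function.Injective nr → Function.Injective nv →
          SPLogic.DecidableInPTime (SPLogic.Implication.encode nr nv) (SPLogic.SPi Ax)) := by
  -- A total choice of profiles is convenient; outside `Ax` it is arbitrary.
  have hHorn' : ∀ ι : SPLogic.Implication R, ∃ π : SPLogic.Profile R, ι ∈ Ax → π.IsProfileOf ι :=
    fun ι => by
      by_cases h : ι ∈ Ax
      · exact (hHorn ι h).imp fun π hπ _ => hπ
      · exact ⟨Classical.arbitrary _, fun h' => absurd h' h⟩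
  choose π hπ using hHorn'
  refine ⟨SPLogic.hasPolyFiniteFrameProperty hfin hπ,
    fun π' hπ' σ τ => SPLogic.krConsequence_iff hπ' σ τ, fun hc nr nv hnr hnv => ?_⟩
  have h : SPLogic.SPi Ax = {ι | SPLogic.KrConsequence Ax ι} :=
    Set.ext fun ι => (SPLogic.mem_SPi_iff Ax ι).trans (hc ι).symm
  rw [h]
  exact SPLogic.decidableInPTime_krConsequence hfin hπ hnr hnv
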